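/- **Setting.** Let $X=\mathbb A_{\mathbb Q}^\times/\mathbb Q^\times$ be the idele class group with a Haar measure $d^\times x$, let $(\pi(g)\Phi)(x)=\Phi(xg)$ be the right regular representation of $\mathbb A_{\mathbb Q}^\times$ on $L^2(X)$, and for $\Phi_0\in L^2(X)$ let $$\mathcal H_{\rm phys}=\overline{\operatorname{span}}\{\pi(g)\Phi_0: g\in\mathbb A_{\mathbb Q}^\times\}\subset L^2(X),\qquad \mathcal H^{(2)}_{\rm phys}=\mathcal H_{\rm phys}\oplus\mathcal H_{\rm phys}.$$ Let $U\in C^\infty(\mathbb R)$ be real-valued and $L$-periodic with $L>0$, let $E_*\in\mathbb R$, and put $$H_\infty=-\frac{d^2}{dy^2}+U(y),\quad D(H_\infty)=H^2(\mathbb R),\qquad Q_\infty=H_\infty-E_*I,\qquad D_\infty=\begin{pmatrix}0&Q_\infty\\Q_\infty&0\end{pmatrix}\ \text{ on } H^2(\mathbb R)\oplus H^2(\mathbb R).$$ Fix a complex Hilbert space $\mathcal H_{\rm fin}$ and a unitary identification $L^2(X)\cong L^2(\mathbb R,dy)\,\widehat\otimes\,\mathcal H_{\rm fin}$ (the result holds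 for every such choice), and let $D_{\rm glob}=D_\infty\,\widehat\otimes\, I_{\rm fin}$ in $L^2(X)\oplus L^2(X)$ be the closure of $D_\infty\otimes I_{\rm fin}$ on the algebraic tensor product $D(D_\infty)\otimes\mathcal H_{\rm fin}$. Assume that $\mathcal H^{(2)}_{\rm phys}$ is a reducing subspace for $D_{\rm glob}$ (the orthogonal projection $P$ onto it satisfies $P D_{\rm glob}\subseteq D_{\rm glob}P$), and write $D_{\rm glob}$ also for its part in $\mathcal H^{(2)}_{\rm phys}$. For each prime $p$ let $T_p$ be a bounded self-adjoint operator on $\mathcal H_{\rm phys}$, let $\eta_p:\mathbb R\to\mathbb R$ be a bounded Borel function with $\|\eta_p\|_\infty=\sup_{\lambda\in\mathbb R}|\eta_p(\lambda)|$, let $M_p=\eta_p(T_p)$ be given by the Borel functional calculus, and put $$\mathcal M_p=\begin{pmatrix}0&M_p\\M_p&0\end{pmatrix}\ \text{ on }\mathcal H^{(2)}_{\rm phys}.$$ For a closed operator $A$, $\operatorname{spec}_{\rm ess}(A)$ is the set of $z\in\mathbb C$ such that $A-z$ is not Fredholm; for self-adjoint $A$ this is the spectrum without the isolated eigenvalues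 of finite multiplicity. **Proposition (self-adjointness and essential spectrum).** The spherical Hecke operators on $\mathcal H_{\rm phys}$, $(T_p\Psi)(x)=\Psi(x\varpi_p)+\Psi(x\varpi_p^{-1})$, where $\varpi_p$ is the idele with component $p$ at the place $p$ and $1$ elsewhere, are bounded and self-adjoint, hence an admissible choice of $(T_p)$. For every choice of $(T_p)$ and $(\eta_p)$ as above, assume $\sum_p\|\eta_p\|_\infty<\infty$. Then: 1. the series $\mathcal M=\sum_p\mathcal M_p$ converges unconditionally in operator norm, and $\mathcal M$ is bounded and self-adjoint on $\mathcal H^{(2)}_{\rm phys}$; 2. $D_{\rm arith}:=D_{\rm glob}+\mathcal M$ with domain $D(D_{\rm arith})=D(D_{\rm glob})\subset\mathcal H^{(2)}_{\rm phys}$ is densely defined and self-adjoint; 3. if in addition each $M_p=\eta_p(T_p)$ is compact and $\sum_p\|M_p\|<\infty$, then $\mathcal M$ is compact and $$\operatorname{spec}_{\rm ess}(D_{\rm arith})=\operatorname{spec}_{\rm ess}(D_{\rm glob}).$$ -/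

import Mathlib

open MeasureTheory Filter Topology Set
open scoped RestrictedProduct TensorProduct InnerProductSpace ContDiff CompactlySupported

noncomputable section

namespace AdelicDirac

/-! ### Ideles, the space `L²(X)`, and Hecke operators -/

/-- The set of prime numbers. -/
abbrev PrimeNumber : Type := {p : ℕ // p.Prime}

instance primeNumberFact (p : PrimeNumber) : Fact (p.1.Prime) := ⟨p.2⟩

/-- The group `ℤ_p^×` of `p`-adic units inside `ℚ_p^×`. -/
def localUnits (p : PrimeNumber) : Subgroup ℚ_[p.1]ˣ where
  carrier := {u | ‖(u : ℚ_[p.1])‖ = 1}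
  mul_mem' := by
    intro a b ha hb
    simp only [mem_ofPred_eq, Units.val_mul, norm_mul] at *
    rw [ha, hb, one_mul]
  one_mem' := by simp
  inv_mem' := by
    intro a ha
    simp only [mem_ofPred_eq, Units.val_inv_eq_inv_val, norm_inv] at *
    rw [ha, inv_one]

instance localUnits_isOpen :
    Fact (∀ p : PrimeNumber, IsOpen (localUnits p : Set ℚ_[p.1]ˣ)) := by
  refine ⟨fun p => ?_⟩
  have h : IsOpen (Metric.sphere (0 : ℚ_[p.1]) 1) :=
    IsUltrametricDist.isOpen_sphere _ one_ne_zero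
  have h2 := h.preimage (Units.continuous_val (M := ℚ_[p.1]))
  convert h2 using 1
  ext u
  simp [localUnits]

instance localUnits_compactSpace (p : PrimeNumber) : CompactSpace (localUnits p) := by
  refine isCompact_iff_compactSpace.1 ?_
  have hc : IsClosedEmbedding (Units.embedProduct ℚ_[p.1]) := Units.isClosedEmbedding_embedProduct
  have hK : IsCompact ((Metric.closedBall (0 : ℚ_[p.1]) 1) ×ˢ
      (MulOpposite.unop ⁻¹' (Metric.closedBall (0 : ℚ_[p.1]) 1))) :=
    (isCompact_closedBall _ _).prod
      ((MulOpposite.opHomeomorph (M := ℚ_[p.1])).symm.isCompact_preimage.2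
        (isCompact_closedBall _ _))
  convert hc.isCompact_preimage hK using 1
  ext u
  have hu : 0 < ‖(u : ℚ_[p.1])‖ := norm_pos_iff.2 u.ne_zero
  simp only [mem_preimage, mem_prod, Units.embedProduct_apply,
    Metric.mem_closedBall, dist_zero_right, MulOpposite.unop_op, Units.val_inv_eq_inv_val, norm_inv]
  change ‖(u : ℚ_[p.1])‖ = 1 ↔ _
  constructor
  · intro h
    rw [h]; simp
  · rintro ⟨h1, h2⟩
    exact le_antisymm h1 ((inv_le_one₀ hu).1 h2)

/-- The finite ideles: the restricted product of the `ℚ_p^×` with respect to the `ℤ_p^×`. -/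
abbrev FiniteIdeles : Type := Πʳ p : PrimeNumber, [ℚ_[p.1]ˣ, localUnits p]

/-- The idele group of `ℚ`. -/
abbrev Ideles : Type := ℝˣ × FiniteIdeles

theorem eventually_mem_localUnits (q : ℚˣ) :
    ∀ᶠ p : PrimeNumber in cofinite,
      Units.map (algebraMap ℚ ℚ_[p.1]).toMonoidHom q ∈ localUnits p := by
  have hne : (q : ℚ).num.natAbs * (q : ℚ).den ≠ 0 := by simp
  have hfin : {p : PrimeNumber | p.1 ∣ (q : ℚ).num.natAbs * (q : ℚ).den}.Finite := by
    refine Set.Finite.of_finite_image (f := fun p : PrimeNumber => p.1) ?_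
      (Subtype.val_injective.injOn)
    refine ((q : ℚ).num.natAbs * (q : ℚ).den).divisors.finite_toSet.subset ?_
    rintro _ ⟨p, hp, rfl⟩
    exact Finset.mem_coe.2 (Nat.mem_divisors.2 ⟨hp, hne⟩)
  filter_upwards [hfin.compl_mem_cofinite] with p hp
  have hp' : ¬ p.1 ∣ (q : ℚ).num.natAbs * (q : ℚ).den := hp
  change ‖(algebraMap ℚ ℚ_[p.1] (q : ℚ))‖ = 1
  rw [Nat.Prime.dvd_mul p.2, not_or] at hp'
  have h1 : ‖(((q : ℚ).num : ℤ) : ℚ_[p.1])‖ = 1 := by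
    refine le_antisymm (Padic.norm_int_le_one _) (not_lt.1 fun h => hp'.1 ?_)
    exact Int.natCast_dvd.1 (Padic.norm_intCast_lt_one_iff.1 h)
  have h2 : ‖(((q : ℚ).den : ℕ) : ℚ_[p.1])‖ = 1 :=
    Padic.norm_natCast_eq_one_iff.2 ((Nat.Prime.coprime_iff_not_dvd p.2).2 hp'.2)
  have h3 : (algebraMap ℚ ℚ_[p.1] (q : ℚ)) = ((q : ℚ).num : ℚ_[p.1]) / ((q : ℚ).den : ℚ_[p.1]) := by
    rw [eq_ratCast]
    exact Rat.cast_def _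
  rw [h3, norm_div, h1, h2, div_one]

/-- The diagonal embedding of `ℚ^×` into the ideles. -/
def principalIdele : ℚˣ →* Ideles where
  toFun q := (Units.map (algebraMap ℚ ℝ).toMonoidHom q,
    ⟨fun p => Units.map (algebraMap ℚ ℚ_[p.1]).toMonoidHom q, eventually_mem_localUnits q⟩)
  map_one' := by
    refine Prod.ext (map_one _) (RestrictedProduct.ext _ _ fun p =>
      map_one (Units.map (algebraMap ℚ ℚ_[p.1]).toMonoidHom))
  map_mul' a b := by
    refine Prod.ext (map_mul _ _ _) (RestrictedProduct.ext _ _ fun p =>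
      map_mul (Units.map (algebraMap ℚ ℚ_[p.1]).toMonoidHom) a b)

/-- The idele class group `X`, the quotient of the ideles by `ℚ^×`. -/
abbrev IdeleClass : Type := Ideles ⧸ principalIdele.range

instance : MeasurableSpace IdeleClass := borel IdeleClass
instance : BorelSpace IdeleClass := ⟨rfl⟩

/-- Haar measure on `X` (unique up to a positive factor). -/
abbrev haarX : Measure IdeleClass := Measure.haar

/-- The adelic Hilbert space `L²(X)`. -/
abbrev L2X : Type := Lp ℂ 2 haarX

theorem haarX_right : haarX.IsMulRightInvariant := by
  refine ⟨fun g => ?_⟩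
  simp_rw [mul_comm _ g]
  exact map_mul_left_eq_self haarX g

/-- The right regular representation of the ideles on `L²(X)`: `(rho g Φ)(x) = Φ(x g)`. -/
def rho (g : Ideles) : L2X →ₗᵢ[ℂ] L2X :=
  Lp.compMeasurePreservingₗᵢ ℂ (fun x : IdeleClass => x * QuotientGroup.mk g)
    (haveI := haarX_right; measurePreserving_mul_right haarX _)

/-- The cyclic subspace of `L²(X)` generated by the seed `Φ₀`: the closed linear span of all
translates of `Φ₀`. -/
def HPhys (Φ₀ : L2X) : Submodule ℂ L2X :=
  (Submodule.span ℂ (Set.range fun g : Ideles => rho g Φ₀)).topologicalClosure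

instance (Φ₀ : L2X) : CompleteSpace (HPhys Φ₀) :=
  (Submodule.isClosed_topologicalClosure _).completeSpace_coe

theorem rho_mul (g h : Ideles) (f : L2X) : rho g (rho h f) = rho (g * h) f := by
  have := haarX_right
  unfold rho
  have := Lp.compMeasurePreserving_comp_apply (p := 2) f
    (measurePreserving_mul_right haarX (QuotientGroup.mk h : IdeleClass))
    (measurePreserving_mul_right haarX (QuotientGroup.mk g : IdeleClass))
  refine (this.symm.trans ?_)
  simp [Function.comp_def, mul_assoc]
  rfl

theorem map_mem_closure_span {E : Type*} [NormedAddCommGroup E] [InnerProductSpace ℂ E]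
    (S : Set E) (A : E →ₗᵢ[ℂ] E) (hA : ∀ x ∈ S, A x ∈ S) {f : E}
    (hf : f ∈ (Submodule.span ℂ S).topologicalClosure) :
    A f ∈ (Submodule.span ℂ S).topologicalClosure := by
  have h : (Submodule.span ℂ S).topologicalClosure ≤
      (Submodule.span ℂ S).topologicalClosure.comap A.toLinearMap := by
    refine Submodule.topologicalClosure_minimal _ ?_ ?_
    · rw [Submodule.span_le]
      intro x hx
      exact Submodule.le_topologicalClosure _ (Submodule.subset_span (hA x hx))
    · exact (Submodule.isClosed_topologicalClosure _).preimage A.continuous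
  exact h hf

theorem rho_mem (Φ₀ : L2X) (g : Ideles) {f : L2X} (hf : f ∈ HPhys Φ₀) : rho g f ∈ HPhys Φ₀ := by
  refine map_mem_closure_span _ (rho g) ?_ hf
  rintro _ ⟨h, rfl⟩
  exact ⟨g * h, (rho_mul g h Φ₀).symm⟩

/-- The idele with component `p` at the prime `p` and `1` at all other places. -/
def uniformizer (p : PrimeNumber) : Ideles :=
  (1, RestrictedProduct.mulSingle localUnits p (Units.mk0 (p.1 : ℚ_[p.1]) (by
    exact_mod_cast p.2.ne_zero)))

/-- The spherical Hecke operator at `p` on the cyclic space of `Φ₀`: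
`(T_p Ψ)(x) = Ψ(x p_p) + Ψ(x p_p⁻¹)`, where `p_p` is the idele with component `p` at `p`. On vectors
fixed by `ℤ_p^×` (so on the whole cyclic space, if the seed is unramified at `p`) this is the action
of the sum of the characteristic functions of `p ℤ_p^×` and `p⁻¹ ℤ_p^×`. -/
def heckeOperator (Φ₀ : L2X) (p : PrimeNumber) : HPhys Φ₀ →L[ℂ] HPhys Φ₀ :=
  ((rho (uniformizer p)).toContinuousLinearMap +
    (rho (uniformizer p)⁻¹).toContinuousLinearMap).restrict
    (p := HPhys Φ₀) (q := HPhys Φ₀)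
    fun _ hf => add_mem (rho_mem Φ₀ _ hf) (rho_mem Φ₀ _ hf)

/-! ### The Hill operator -/

/-- `L²(ℝ)` with complex values and Lebesgue measure. -/
abbrev L2R : Type := Lp ℂ 2 (volume : Measure ℝ)

/-- `g` is the weak derivative of `f`. -/
def IsWeakDeriv (f g : L2R) : Prop :=
  ∀ φ : ℝ → ℂ, ContDiff ℝ ∞ φ → HasCompactSupport φ →
    ∫ y, f y * deriv φ y = - ∫ y, g y * φ y

theorem integrable_mul_test (f : L2R) {φ : ℝ → ℂ} (hφ : Continuous φ) (hs : HasCompactSupport φ) :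
    Integrable (fun y => f y * φ y) :=
  MemLp.integrable_mul (p := 2) (q := 2) (Lp.memLp f) (hφ.memLp_of_hasCompactSupport hs)

theorem IsWeakDeriv.zero : IsWeakDeriv 0 0 := by
  intro φ _ _
  have h0 : ((0 : L2R) : ℝ → ℂ) =ᵐ[volume] 0 := Lp.coeFn_zero _ _ _
  have h1 : ∀ ψ : ℝ → ℂ, ∫ y, (0 : L2R) y * ψ y = 0 := fun ψ => by
    rw [← integral_zero ℝ ℂ]
    exact integral_congr_ae (h0.mono fun y hy => by simp)
  simp

theorem IsWeakDeriv.add {f g f' g' : L2R} (h : IsWeakDeriv f g) (h' : IsWeakDeriv f' g') :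
    IsWeakDeriv (f + f') (g + g') := by
  intro φ hφ hs
  have key : ∀ (a b : L2R) (ψ : ℝ → ℂ), Continuous ψ → HasCompactSupport ψ →
      ∫ y, (a + b : L2R) y * ψ y = (∫ y, a y * ψ y) + ∫ y, b y * ψ y := by
    intro a b ψ hψ hs
    rw [← integral_add (integrable_mul_test a hψ hs) (integrable_mul_test b hψ hs)]
    exact integral_congr_ae ((Lp.coeFn_add a b).mono fun y hy => by
      simp only [hy, Pi.add_apply, add_mul])
  rw [key f f' _ (hφ.continuous_deriv (by simp)) hs.deriv, key g g' _ hφ.continuous hs,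
    h φ hφ hs, h' φ hφ hs]
  ring

theorem IsWeakDeriv.smul {f g : L2R} (c : ℂ) (h : IsWeakDeriv f g) :
    IsWeakDeriv (c • f) (c • g) := by
  intro φ hφ hs
  have key : ∀ (a : L2R) (ψ : ℝ → ℂ), ∫ y, (c • a : L2R) y * ψ y = c * ∫ y, a y * ψ y := by
    intro a ψ
    rw [← integral_const_mul]
    exact integral_congr_ae ((Lp.coeFn_smul c a).mono fun y hy => by
      simp [hy, mul_assoc])
  rw [key, key, h φ hφ hs]
  ring

/-- The graph of `-d²/dy² + U` on `H²(ℝ)`: the pairs `(f, k)` such that `f` has weak derivatives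
`f' = g` and `f'' = h` in `L²(ℝ)` and `k = -h + U f`. -/
def hillGraph (U : ℝ → ℝ) : Submodule ℂ (L2R × L2R) where
  carrier := {q | ∃ g h : L2R, IsWeakDeriv q.1 g ∧ IsWeakDeriv g h ∧
    q.2 =ᵐ[volume] fun y => - h y + (U y : ℂ) * q.1 y}
  zero_mem' := by
    refine ⟨0, 0, IsWeakDeriv.zero, IsWeakDeriv.zero, ?_⟩
    have h0 : ((0 : L2R) : ℝ → ℂ) =ᵐ[volume] 0 := Lp.coeFn_zero _ _ _
    exact h0.mono fun y hy => by simp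
  add_mem' := by
    rintro a b ⟨g, h, h1, h2, h3⟩ ⟨g', h', h1', h2', h3'⟩
    refine ⟨g + g', h + h', h1.add h1', h2.add h2', ?_⟩
    filter_upwards [h3, h3', Lp.coeFn_add h h', Lp.coeFn_add a.1 b.1, Lp.coeFn_add a.2 b.2]
      with y e1 e2 e3 e4 e5
    simp only [Prod.snd_add, Prod.fst_add]
    rw [e3, e4, e5]
    simp only [Pi.add_apply]
    rw [e1, e2]
    ring
  smul_mem' := by
    rintro c a ⟨g, h, h1, h2, h3⟩
    refine ⟨c • g, c • h, h1.smul c, h2.smul c, ?_⟩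
    filter_upwards [h3, Lp.coeFn_smul c h, Lp.coeFn_smul c a.1, Lp.coeFn_smul c a.2]
      with y e1 e3 e4 e5
    simp only [Prod.smul_snd, Prod.smul_fst]
    rw [e3, e4, e5]
    simp only [Pi.smul_apply, smul_eq_mul]
    rw [e1]
    ring

theorem IsWeakDeriv.eq_zero {g : L2R} (h : IsWeakDeriv 0 g) : g = 0 := by
  have h0 : ((0 : L2R) : ℝ → ℂ) =ᵐ[volume] 0 := Lp.coeFn_zero _ _ _
  have h1 : ∀ ψ : ℝ → ℂ, ∫ y, (0 : L2R) y * ψ y = 0 := fun ψ => by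
    rw [← integral_zero ℝ ℂ]
    exact integral_congr_ae (h0.mono fun y hy => by simp)
  have h2 : ∀ᵐ y, g y = 0 := by
    refine ae_eq_zero_of_integral_contDiff_smul_eq_zero
      ((Lp.memLp g).locallyIntegrable (by norm_num)) ?_
    intro φ hφ hs
    have h3 := h (fun y => (φ y : ℂ)) (Complex.ofRealCLM.contDiff.comp hφ)
      (hs.comp_left (g := fun x : ℝ => (x : ℂ)) (by simp))
    rw [h1] at h3
    simpa [mul_comm, neg_eq_zero] using h3.symm
  exact Lp.ext (Filter.EventuallyEq.trans h2 h0.symm)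

theorem hillGraph_single_valued (U : ℝ → ℝ) (q : L2R × L2R) (hq : q ∈ hillGraph U)
    (h0 : q.1 = 0) : q.2 = 0 := by
  obtain ⟨g, h, h1, h2, h3⟩ := hq
  rw [h0] at h1
  have hg := h1.eq_zero
  rw [hg] at h2
  have hh := h2.eq_zero
  rw [h0, hh] at h3
  have hz : ((0 : L2R) : ℝ → ℂ) =ᵐ[volume] 0 := Lp.coeFn_zero _ _ _
  refine Lp.ext ?_
  filter_upwards [h3, hz] with y e1 e2
  rw [e1, e2]
  simp

/-- The Hill operator `H_∞ = -d²/dy² + U` in `L²(ℝ)`; for bounded measurable `U` its domain is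
`H²(ℝ)`. Its graph is single-valued by `hillGraph_single_valued`. -/
def hillOperator (U : ℝ → ℝ) : L2R →ₗ.[ℂ] L2R := (hillGraph U).toLinearPMap

/-- `Q_∞ = H_∞ - E_*`. -/
def qInf (U : ℝ → ℝ) (Estar : ℝ) : L2R →ₗ.[ℂ] L2R :=
  (-((Estar : ℂ) • LinearMap.id : L2R →ₗ[ℂ] L2R)) +ᵥ hillOperator U

/-! ### Operators in Hilbert spaces -/

section Abstract
variable {E : Type*} [NormedAddCommGroup E] [InnerProductSpace ℂ E]

/-- The orthogonal sum `E ⊕ E` of two copies of a Hilbert space. -/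
abbrev Double (E : Type*) : Type _ := WithLp 2 (E × E)

/-- The operator matrix with zero diagonal and both other entries equal to `A`,
`(f, g) ↦ (A g, A f)`, on `D(A) ⊕ D(A)`. -/
def chiral (A : E →ₗ.[ℂ] E) : Double E →ₗ.[ℂ] Double E where
  domain := (A.domain.prod A.domain).comap (WithLp.linearEquiv 2 ℂ (E × E)).toLinearMap
  toFun :=
    { toFun := fun x => WithLp.toLp 2 (A ⟨x.1.snd, x.2.2⟩, A ⟨x.1.fst, x.2.1⟩)
      map_add' := fun x y => by
        rw [← WithLp.toLp_add, Prod.mk_add_mk, ← A.map_add, ← A.map_add]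
        rfl
      map_smul' := fun c x => by
        rw [RingHom.id_apply, ← WithLp.toLp_smul, Prod.smul_mk, ← A.map_smul, ← A.map_smul]
        rfl }

/-- The same operator matrix for a bounded operator: `(f, g) ↦ (M g, M f)`. -/
def chiralCLM (M : E →L[ℂ] E) : Double E →L[ℂ] Double E :=
  (WithLp.prodContinuousLinearEquiv 2 ℂ E E).symm.toContinuousLinearMap ∘L
    ((M ∘L ContinuousLinearMap.snd ℂ E E).prod (M ∘L ContinuousLinearMap.fst ℂ E E)) ∘L
      (WithLp.prodContinuousLinearEquiv 2 ℂ E E).toContinuousLinearMap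

/-- The diagonal operator `(f, g) ↦ (M f, M g)`. -/
def diagCLM {F : Type*} [NormedAddCommGroup F] [InnerProductSpace ℂ F] (M : E →L[ℂ] F) :
    Double E →L[ℂ] Double F :=
  (WithLp.prodContinuousLinearEquiv 2 ℂ F F).symm.toContinuousLinearMap ∘L
    (M.prodMap M) ∘L (WithLp.prodContinuousLinearEquiv 2 ℂ E E).toContinuousLinearMap

/-- The essential spectrum of an unbounded operator: the `z` for which `A - z` is not Fredholm,
where Fredholm means finite-dimensional kernel and closed range of finite codimension. For
self-adjoint `A` this is the spectrum without the isolated eigenvalues of finite multiplicity. -/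
def essSpectrum (A : E →ₗ.[ℂ] E) : Set ℂ :=
  {z | ¬ (FiniteDimensional ℂ (LinearMap.ker (A.toFun - z • A.domain.subtype)) ∧
      IsClosed (LinearMap.range (A.toFun - z • A.domain.subtype) : Set E) ∧
      FiniteDimensional ℂ (E ⧸ LinearMap.range (A.toFun - z • A.domain.subtype)))}

/-- The orthogonal projection `P` commutes with `D`, that is `P D ⊆ D P`: the range of `P` is a
reducing subspace of `D`. -/
def IsReducedBy (P : E →L[ℂ] E) (D : E →ₗ.[ℂ] E) : Prop :=
  ∀ x : D.domain, ∃ h : P x ∈ D.domain, D ⟨P x, h⟩ = P (D x)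

/-- The Hilbert space tensor product: the completion of the algebraic one. -/
abbrev HilbertTensor (E K : Type*) [NormedAddCommGroup E] [InnerProductSpace ℂ E]
    [NormedAddCommGroup K] [InnerProductSpace ℂ K] : Type _ :=
  UniformSpace.Completion (E ⊗[ℂ] K)

/-- The part of `D` in a subspace `F`, embedded by `J`: its domain consists of the `x` in `F` with
`J x ∈ D(D)` and `D (J x)` in `F`, and it acts there as `D`. -/
def part {F : Type*} [NormedAddCommGroup F] [InnerProductSpace ℂ F] (J : F →L[ℂ] E)
    (D : E →ₗ.[ℂ] E) : F →ₗ.[ℂ] F :=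
  (D.graph.comap (J.prodMap J).toLinearMap).toLinearPMap

variable {K H : Type*} [NormedAddCommGroup K] [InnerProductSpace ℂ K]
  [NormedAddCommGroup H] [InnerProductSpace ℂ H]

/-- The elementary tensor `ψ ⊗ k` of `ψ = (ψ₁, ψ₂) ∈ E ⊕ E` and `k ∈ K`, as the element
`(ψ₁ ⊗ k, ψ₂ ⊗ k)` of `H ⊕ H`, where `H` is identified with the tensor product of `E` and `K`
by the unitary `W`. -/
def pureTensor (W : H ≃ₗᵢ[ℂ] HilbertTensor E K) (ψ : Double E) (k : K) : Double H :=
  WithLp.toLp 2 (W.symm ↑(ψ.fst ⊗ₜ[ℂ] k), W.symm ↑(ψ.snd ⊗ₜ[ℂ] k))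

/-- The operator `D ⊗ I` in `H ⊕ H`, where `H` is identified with the tensor product of `E` and
`K`: the closure of the operator `ψ ⊗ k ↦ (D ψ) ⊗ k` on the span of the `ψ ⊗ k` with
`ψ ∈ D(D)` and `k ∈ K`. -/
def tensorId (W : H ≃ₗᵢ[ℂ] HilbertTensor E K) (D : Double E →ₗ.[ℂ] Double E) :
    Double H →ₗ.[ℂ] Double H :=
  (Submodule.span ℂ (Set.range fun q : D.domain × K =>
    (pureTensor W q.1 q.2, pureTensor W (D q.1) q.2))).topologicalClosure.toLinearPMap

end Abstract

/-! ### Borel functional calculus -/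

section BorelCalculus

variable {H : Type*} [NormedAddCommGroup H] [InnerProductSpace ℂ H] [CompleteSpace H]

/-- The positive functional `f ↦ ⟨x, f(T) x⟩` on continuous functions of compact support, for a
bounded self-adjoint operator `T`; `f(T)` is given by the continuous functional calculus. -/
def spectralFunctional (T : H →L[ℂ] H) (x : H) : C_c(ℝ, ℝ) →ₚ[ℝ] ℝ :=
  PositiveLinearMap.mk₀
    { toFun := fun f => (⟪x, cfc (f : ℝ → ℝ) T x⟫_ℂ).re
      map_add' := fun f g => by
        have h : cfc ((f + g : C_c(ℝ, ℝ)) : ℝ → ℝ) T = cfc (f : ℝ → ℝ) T + cfc (g : ℝ → ℝ) T :=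
          cfc_add (a := T) f g f.continuous.continuousOn g.continuous.continuousOn
        rw [h, add_apply, inner_add_right, Complex.add_re]
      map_smul' := fun c f => by
        have h : cfc ((c • f : C_c(ℝ, ℝ)) : ℝ → ℝ) T = c • cfc (f : ℝ → ℝ) T :=
          cfc_smul c f T f.continuous.continuousOn
        simp only [h, smul_apply, RingHom.id_apply, smul_eq_mul]
        rw [← Complex.coe_smul, inner_smul_right, Complex.re_ofReal_mul] }
    (fun f hf => by
      have h : (0 : H →L[ℂ] H) ≤ cfc (f : ℝ → ℝ) T := cfc_nonneg fun y _ => hf y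
      have h2 := ((ContinuousLinearMap.nonneg_iff_isPositive _).1 h).re_inner_nonneg_right x
      exact h2)

/-- The spectral measure of the self-adjoint operator `T` at the vector `x`. -/
def spectralMeasure (T : H →L[ℂ] H) (x : H) : Measure ℝ :=
  RealRMK.rieszMeasure (spectralFunctional T x)

theorem integral_spectralMeasure (T : H →L[ℂ] H) (x : H) (f : C_c(ℝ, ℝ)) :
    ∫ t, f t ∂(spectralMeasure T x) = (⟪x, cfc (f : ℝ → ℝ) T x⟫_ℂ).re :=
  RealRMK.integral_rieszMeasure _ f

theorem spectralMeasure_univ_le (T : H →L[ℂ] H) (x : H) :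
    spectralMeasure T x univ ≤ ENNReal.ofReal (‖x‖ ^ 2) := by
  have hK : ∀ n : ℕ, spectralMeasure T x (Metric.closedBall 0 n) ≤ ENNReal.ofReal (‖x‖ ^ 2) := by
    intro n
    obtain ⟨f, h1, -, h2, h3⟩ := exists_continuous_one_zero_of_isCompact
      (isCompact_closedBall (0 : ℝ) n) isClosed_empty (by simp)
    have h4 := RealRMK.rieszMeasure_le_of_eq_one (spectralFunctional T x) (f := ⟨f, h2⟩)
      (fun t => (h3 t).1) (isCompact_closedBall (0 : ℝ) n) (fun t ht => h1 ht)
    refine h4.trans (ENNReal.ofReal_le_ofReal ?_)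
    change (⟪x, cfc (f : ℝ → ℝ) T x⟫_ℂ).re ≤ _
    have h5 : ‖cfc (f : ℝ → ℝ) T‖ ≤ 1 := norm_cfc_le zero_le_one fun t _ => by
      rw [Real.norm_of_nonneg (h3 t).1]
      exact (h3 t).2
    calc (⟪x, cfc (f : ℝ → ℝ) T x⟫_ℂ).re ≤ ‖⟪x, cfc (f : ℝ → ℝ) T x⟫_ℂ‖ := Complex.re_le_norm _
      _ ≤ ‖x‖ * ‖cfc (f : ℝ → ℝ) T x‖ := norm_inner_le_norm _ _
      _ ≤ ‖x‖ * (1 * ‖x‖) := by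
        gcongr
        exact (cfc (f : ℝ → ℝ) T).le_of_opNorm_le h5 x
      _ = ‖x‖ ^ 2 := by ring
  have hU : (⋃ n : ℕ, Metric.closedBall (0 : ℝ) n) = univ := Metric.iUnion_closedBall_nat 0
  rw [← hU, Monotone.measure_iUnion]
  · exact iSup_le hK
  · intro m n hmn
    exact Metric.closedBall_subset_closedBall (by exact_mod_cast hmn)

instance (T : H →L[ℂ] H) (x : H) : IsFiniteMeasure (spectralMeasure T x) :=
  ⟨(spectralMeasure_univ_le T x).trans_lt ENNReal.ofReal_lt_top⟩

/-- The quadratic form `x ↦ ∫ η dμ_x`. -/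
def spectralForm (T : H →L[ℂ] H) (η : ℝ → ℝ) (x : H) : ℝ := ∫ t, η t ∂(spectralMeasure T x)

theorem abs_spectralForm_le (T : H →L[ℂ] H) {η : ℝ → ℝ} {C : ℝ}
    (hC : ∀ t, |η t| ≤ C) (x : H) : |spectralForm T η x| ≤ C * ‖x‖ ^ 2 := by
  have h := norm_integral_le_of_norm_le_const (μ := spectralMeasure T x) (f := η)
    (Eventually.of_forall fun t => hC t)
  refine h.trans ?_
  have hC0 : 0 ≤ C := (abs_nonneg _).trans (hC 0)
  gcongr
  exact ENNReal.toReal_le_of_le_ofReal (by positivity) (spectralMeasure_univ_le T x)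

theorem integrable_spectralMeasure (T : H →L[ℂ] H) {η : ℝ → ℝ} (hη : Measurable η) {C : ℝ}
    (hC : ∀ t, |η t| ≤ C) (x : H) : Integrable η (spectralMeasure T x) :=
  Integrable.of_bound hη.aestronglyMeasurable C (Eventually.of_forall hC)

/-- Linear relations between the forms `x ↦ re ⟪x, A x⟫`, valid for every bounded `A`, pass to
the spectral form. -/
theorem spectralForm_relation (T : H →L[ℂ] H) {η : ℝ → ℝ} (hη : Measurable η) {C : ℝ}
    (hC : ∀ t, |η t| ≤ C) {n : ℕ} (c : Fin n → ℝ) (v : Fin n → H)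
    (h : ∀ A : H →L[ℂ] H, ∑ i, c i * (⟪v i, A (v i)⟫_ℂ).re = 0) :
    ∑ i, c i * spectralForm T η (v i) = 0 := by
  have key : ∀ (d : Fin n → NNReal) (g : ℝ → ℝ), (∀ i, Integrable g (spectralMeasure T (v i))) →
      ∫ t, g t ∂(∑ i, d i • spectralMeasure T (v i)) =
        ∑ i, (d i : ℝ) * ∫ t, g t ∂(spectralMeasure T (v i)) := by
    intro d g hg
    rw [integral_finsetSum_measure]
    · refine Finset.sum_congr rfl fun i _ => ?_
      rw [integral_smul_nnreal_measure]
      rfl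
    · intro i _
      exact (hg i).smul_measure_nnreal
  have hd : ∀ i, c i = ((c i).toNNReal : ℝ) - ((-c i).toNNReal : ℝ) := fun i => by
    simp only [Real.coe_toNNReal']
    exact (max_zero_sub_max_neg_zero_eq_self (c i)).symm
  have hsplit : ∀ w : Fin n → ℝ, ∑ i, c i * w i =
      (∑ i, ((c i).toNNReal : ℝ) * w i) - ∑ i, ((-c i).toNNReal : ℝ) * w i := by
    intro w
    rw [← Finset.sum_sub_distrib]
    refine Finset.sum_congr rfl fun i _ => ?_
    nth_rewrite 1 [hd i]
    ring
  have hμ : (∑ i, (c i).toNNReal • spectralMeasure T (v i)) =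
      ∑ i, (-c i).toNNReal • spectralMeasure T (v i) := by
    refine Measure.ext_of_integral_eq_on_compactlySupported fun f => ?_
    have hf : ∀ i, Integrable f (spectralMeasure T (v i)) := fun i =>
      f.continuous.integrable_of_hasCompactSupport f.hasCompactSupport
    rw [key _ _ hf, key _ _ hf, ← sub_eq_zero, ← hsplit]
    simp_rw [integral_spectralMeasure]
    exact h _
  have hi := fun i => integrable_spectralMeasure T hη hC (v i)
  rw [hsplit]
  unfold spectralForm
  rw [← key _ _ hi, ← key _ _ hi, hμ, sub_self]

/-- The real bilinear form obtained from the spectral form by polarisation. -/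
def polarForm (T : H →L[ℂ] H) (η : ℝ → ℝ) (x y : H) : ℝ :=
  (spectralForm T η (x + y) - spectralForm T η (x - y)) / 4

theorem polarForm_add_right (T : H →L[ℂ] H) {η : ℝ → ℝ} (hη : Measurable η) {C : ℝ}
    (hC : ∀ t, |η t| ≤ C) (x y z : H) :
    polarForm T η x (y + z) = polarForm T η x y + polarForm T η x z := by
  have h := spectralForm_relation T hη hC ![1, -1, -1, 1, -1, 1]
    ![x + (y + z), x - (y + z), x + y, x - y, x + z, x - z] (fun A => by
      simp [Fin.sum_univ_succ, inner_add_left, inner_add_right, inner_sub_left, inner_sub_right]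
      ring)
  simp [Fin.sum_univ_succ] at h
  unfold polarForm
  linarith

theorem polarForm_smul_right (T : H →L[ℂ] H) {η : ℝ → ℝ} (hη : Measurable η) {C : ℝ}
    (hC : ∀ t, |η t| ≤ C) (x y : H) (r : ℝ) :
    polarForm T η x ((r : ℂ) • y) = r * polarForm T η x y := by
  have h := spectralForm_relation T hη hC ![1, -1, -r, r]
    ![x + (r : ℂ) • y, x - (r : ℂ) • y, x + y, x - y] (fun A => by
      simp [Fin.sum_univ_succ, inner_add_left, inner_add_right, inner_sub_left, inner_sub_right,
        inner_smul_left, inner_smul_right]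
      ring)
  simp [Fin.sum_univ_succ] at h
  unfold polarForm
  simp only [Complex.coe_smul]
  linarith

theorem polarForm_comm (T : H →L[ℂ] H) {η : ℝ → ℝ} (hη : Measurable η) {C : ℝ}
    (hC : ∀ t, |η t| ≤ C) (x y : H) : polarForm T η x y = polarForm T η y x := by
  have h := spectralForm_relation T hη hC ![1, -1, -1, 1]
    ![x + y, x - y, y + x, y - x] (fun A => by
      simp [Fin.sum_univ_succ, inner_add_left, inner_add_right, inner_sub_left, inner_sub_right]
      ring)
  simp [Fin.sum_univ_succ] at h
  unfold polarForm
  linarith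

theorem polarForm_I (T : H →L[ℂ] H) {η : ℝ → ℝ} (hη : Measurable η) {C : ℝ}
    (hC : ∀ t, |η t| ≤ C) (x y : H) :
    polarForm T η (Complex.I • x) y = - polarForm T η x (Complex.I • y) := by
  have h := spectralForm_relation T hη hC ![1, -1, 1, -1]
    ![Complex.I • x + y, Complex.I • x - y, x + Complex.I • y, x - Complex.I • y] (fun A => by
      simp [Fin.sum_univ_succ, inner_add_left, inner_add_right, inner_sub_left, inner_sub_right,
        inner_smul_left, inner_smul_right]
      ring)
  simp [Fin.sum_univ_succ] at h
  unfold polarForm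
  linarith

theorem polarForm_self (T : H →L[ℂ] H) {η : ℝ → ℝ} (hη : Measurable η) {C : ℝ}
    (hC : ∀ t, |η t| ≤ C) (x : H) : polarForm T η x x = spectralForm T η x := by
  have h := spectralForm_relation T hη hC ![1, -1, -4]
    ![x + x, x - x, x] (fun A => by
      simp [Fin.sum_univ_succ, inner_add_left, inner_add_right]
      ring)
  simp [Fin.sum_univ_succ] at h
  unfold polarForm
  simp
  linarith

theorem polarForm_self_I (T : H →L[ℂ] H) {η : ℝ → ℝ} (hη : Measurable η) {C : ℝ}
    (hC : ∀ t, |η t| ≤ C) (x : H) : polarForm T η x (Complex.I • x) = 0 := by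
  have h1 := polarForm_I T hη hC x x
  have h2 := polarForm_comm T hη hC (Complex.I • x) x
  linarith

theorem abs_polarForm_le (T : H →L[ℂ] H) {η : ℝ → ℝ} (hη : Measurable η) {C : ℝ}
    (hC : ∀ t, |η t| ≤ C) (x y : H) : |polarForm T η x y| ≤ C * (‖x‖ * ‖y‖) := by
  have hC0 : 0 ≤ C := (abs_nonneg _).trans (hC 0)
  have h1 : ∀ x y : H, |polarForm T η x y| ≤ C * ((‖x‖ ^ 2 + ‖y‖ ^ 2) / 2) := by
    intro x y
    have e1 := abs_le.1 (abs_spectralForm_le T hC (x + y))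
    have e2 := abs_le.1 (abs_spectralForm_le T hC (x - y))
    have e3 : ‖x + y‖ ^ 2 + ‖x - y‖ ^ 2 = 2 * (‖x‖ ^ 2 + ‖y‖ ^ 2) := by
      have := parallelogram_law_with_norm ℂ x y
      nlinarith
    have e4 : C * ‖x + y‖ ^ 2 + C * ‖x - y‖ ^ 2 = 2 * (C * (‖x‖ ^ 2 + ‖y‖ ^ 2)) := by
      rw [← mul_add, e3]; ring
    unfold polarForm
    rw [abs_le]
    constructor <;> linarith [e1.1, e1.2, e2.1, e2.2]
  have hl : ∀ (r : ℝ) (x y : H), polarForm T η ((r : ℂ) • x) y = r * polarForm T η x y := by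
    intro r x y
    rw [polarForm_comm T hη hC, polarForm_smul_right T hη hC, polarForm_comm T hη hC]
  have hz : ∀ x : H, polarForm T η x 0 = 0 := fun x => by simp [polarForm]
  by_cases hx : x = 0
  · rw [hx, polarForm_comm T hη hC, hz]; simp
  by_cases hy : y = 0
  · rw [hy, hz]; simp
  have hx' : 0 < ‖x‖ := norm_pos_iff.2 hx
  have hy' : 0 < ‖y‖ := norm_pos_iff.2 hy
  have h2 := h1 (((‖y‖ : ℝ) : ℂ) • x) (((‖x‖ : ℝ) : ℂ) • y)
  rw [hl, polarForm_smul_right T hη hC, norm_smul, norm_smul, Complex.norm_real, Complex.norm_real,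
    norm_norm, norm_norm, ← mul_assoc, abs_mul, abs_of_pos (mul_pos hy' hx')] at h2
  have h3 : ‖y‖ * ‖x‖ * |polarForm T η x y| ≤ ‖y‖ * ‖x‖ * (C * (‖x‖ * ‖y‖)) := by
    refine h2.trans (le_of_eq ?_)
    ring
  exact le_of_mul_le_mul_left h3 (mul_pos hy' hx')

/-- Existence of the Borel functional calculus. -/
theorem exists_borelCalculus (T : H →L[ℂ] H) {η : ℝ → ℝ} (hη : Measurable η) {C : ℝ}
    (hC : ∀ t, |η t| ≤ C) :
    ∃ M : H →L[ℂ] H, ∀ x : H, ⟪x, M x⟫_ℂ = ((∫ t, η t ∂(spectralMeasure T x) : ℝ) : ℂ) := by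
  have hC0 : 0 ≤ C := (abs_nonneg _).trans (hC 0)
  have addR := polarForm_add_right T hη hC
  have smulR := polarForm_smul_right T hη hC
  have comm := polarForm_comm T hη hC
  have mulI := polarForm_I T hη hC
  have addL : ∀ x y z : H, polarForm T η (x + y) z = polarForm T η x z + polarForm T η y z := by
    intro x y z
    rw [comm, addR, comm z x, comm z y]
  have smulL : ∀ (x y : H) (r : ℝ),
      polarForm T η ((r : ℂ) • x) y = r * polarForm T η x y := by
    intro x y r
    rw [comm, smulR, comm]
  have negR : ∀ x y : H, polarForm T η x (-y) = - polarForm T η x y := fun x y => by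
    have := smulR x y (-1)
    simpa using this
  have II : ∀ y : H, Complex.I • Complex.I • y = -y := fun y => by
    rw [smul_smul, Complex.I_mul_I, neg_one_smul]
  have dec : ∀ (c : ℂ) (y : H), c • y = (c.re : ℂ) • y + (c.im : ℂ) • Complex.I • y := by
    intro c y
    rw [smul_smul, ← add_smul, Complex.re_add_im]
  let b : H → H → ℂ := fun x y =>
    (polarForm T η x y : ℂ) - Complex.I * (polarForm T η x (Complex.I • y) : ℂ)
  have badd : ∀ x y z, b x (y + z) = b x y + b x z := by
    intro x y z
    simp only [b, smul_add, addR]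
    push_cast
    ring
  have badd' : ∀ x y z, b (x + y) z = b x z + b y z := by
    intro x y z
    simp only [b, addL]
    push_cast
    ring
  have bsmul : ∀ (c : ℂ) (x y : H), b x (c • y) = c * b x y := by
    intro c x y
    have e1 : polarForm T η x (c • y) =
        c.re * polarForm T η x y + c.im * polarForm T η x (Complex.I • y) := by
      rw [dec c y, addR, smulR, smulR]
    have e2 : polarForm T η x (Complex.I • c • y) =
        c.re * polarForm T η x (Complex.I • y) - c.im * polarForm T η x y := by
      rw [smul_comm, dec c (Complex.I • y), addR, smulR, smulR, II, negR]
      ring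
    simp only [b, e1, e2]
    apply Complex.ext <;> simp <;> ring
  have bsmul' : ∀ (c : ℂ) (x y : H), b (c • x) y = (starRingEnd ℂ) c * b x y := by
    intro c x y
    have e1 : ∀ y, polarForm T η (c • x) y =
        c.re * polarForm T η x y - c.im * polarForm T η x (Complex.I • y) := by
      intro y
      rw [dec c x, addL, smulL, smulL, mulI]
      ring
    simp only [b, e1, II, negR]
    apply Complex.ext <;> simp <;> ring
  have bbound : ∀ x y, ‖b x y‖ ≤ (2 * C) * ‖x‖ * ‖y‖ := by
    intro x y
    have e1 := abs_polarForm_le T hη hC x y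
    have e2 := abs_polarForm_le T hη hC x (Complex.I • y)
    rw [norm_smul, Complex.norm_I, one_mul] at e2
    refine (norm_sub_le _ _).trans ?_
    rw [norm_mul, Complex.norm_I, one_mul, Complex.norm_real, Complex.norm_real, Real.norm_eq_abs,
      Real.norm_eq_abs]
    linarith
  let B : H →L⋆[ℂ] H →L[ℂ] ℂ := LinearMap.mkContinuous₂
    (LinearMap.mk₂'ₛₗ (starRingEnd ℂ) (RingHom.id ℂ) b badd' bsmul' badd bsmul) (2 * C) bbound
  refine ⟨InnerProductSpace.continuousLinearMapOfBilin B, fun x => ?_⟩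
  have h1 : ⟪InnerProductSpace.continuousLinearMapOfBilin B x, x⟫_ℂ = b x x :=
    InnerProductSpace.continuousLinearMapOfBilin_apply B x x
  have h2 : b x x = ((∫ t, η t ∂(spectralMeasure T x) : ℝ) : ℂ) := by
    simp only [b, polarForm_self T hη hC, polarForm_self_I T hη hC]
    simp [spectralForm]
  rw [← inner_conj_symm, h1, h2, Complex.conj_ofReal]

open Classical in
/-- The Borel functional calculus: for a bounded self-adjoint `T` and a bounded Borel function `η`,
`η(T)` is the bounded operator `M` with `⟨x, M x⟩ = ∫ η dμ_x` for all `x`, where `μ_x` is the spectral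
measure of `T` at `x`. It exists by `exists_borelCalculus`. -/
def borelCalculus (T : H →L[ℂ] H) (η : ℝ → ℝ) : H →L[ℂ] H :=
  if h : ∃ M : H →L[ℂ] H, ∀ x : H,
      ⟪x, M x⟫_ℂ = ((∫ t, η t ∂(spectralMeasure T x) : ℝ) : ℂ)
  then h.choose else 0

theorem inner_borelCalculus (T : H →L[ℂ] H) {η : ℝ → ℝ} (hη : Measurable η) {C : ℝ}
    (hC : ∀ t, |η t| ≤ C) (x : H) :
    ⟪x, borelCalculus T η x⟫_ℂ = ((∫ t, η t ∂(spectralMeasure T x) : ℝ) : ℂ) := by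
  have h := exists_borelCalculus T hη hC
  unfold borelCalculus
  rw [dif_pos h]
  exact h.choose_spec x

end BorelCalculus

/-! ### The adelic Dirac operators -/

/-- The chiral operator `D_∞` at the real place, with off-diagonal entries `Q_∞`. -/
def dInf (U : ℝ → ℝ) (Estar : ℝ) : Double L2R →ₗ.[ℂ] Double L2R := chiral (qInf U Estar)

/-- The background operator `D_glob = D_∞ ⊗ I_fin` in `L²(X) ⊕ L²(X)`, for an identification `W` of
`L²(X)` with the tensor product of `L²(ℝ)` and the finite factor `K`. -/
def dGlob {K : Type*} [NormedAddCommGroup K] [InnerProductSpace ℂ K]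
    (W : L2X ≃ₗᵢ[ℂ] HilbertTensor L2R K) (U : ℝ → ℝ) (Estar : ℝ) :
    Double L2X →ₗ.[ℂ] Double L2X :=
  tensorId W (dInf U Estar)

/-- The inclusion of the doubled physical space in `L²(X) ⊕ L²(X)`. -/
def physIncl (Φ₀ : L2X) : Double (HPhys Φ₀) →L[ℂ] Double L2X := diagCLM (HPhys Φ₀).subtypeL

/-- The orthogonal projection of `L²(X) ⊕ L²(X)` onto the doubled physical space. -/
def physProj (Φ₀ : L2X) : Double L2X →L[ℂ] Double L2X := diagCLM (HPhys Φ₀).starProjection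

/-- The background operator `D_glob` in the doubled physical space. -/
def dGlobPhys {K : Type*} [NormedAddCommGroup K] [InnerProductSpace ℂ K]
    (W : L2X ≃ₗᵢ[ℂ] HilbertTensor L2R K) (U : ℝ → ℝ) (Estar : ℝ) (Φ₀ : L2X) :
    Double (HPhys Φ₀) →ₗ.[ℂ] Double (HPhys Φ₀) :=
  part (physIncl Φ₀) (dGlob W U Estar)

/-- The mass term at `p`, with zero diagonal and off-diagonal entries `M_p = η_p(T_p)`. -/
def massTerm {H : Type*} [NormedAddCommGroup H] [InnerProductSpace ℂ H] [CompleteSpace H]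
    (T : PrimeNumber → H →L[ℂ] H) (η : PrimeNumber → ℝ → ℝ) (p : PrimeNumber) :
    Double H →L[ℂ] Double H :=
  chiralCLM (borelCalculus (T p) (η p))

/-- The mass operator, the sum over all primes of the mass terms in the operator norm. -/
def massOperator {H : Type*} [NormedAddCommGroup H] [InnerProductSpace ℂ H] [CompleteSpace H]
    (T : PrimeNumber → H →L[ℂ] H) (η : PrimeNumber → ℝ → ℝ) : Double H →L[ℂ] Double H :=
  ∑' p, massTerm T η p

/-- The arithmetic Dirac operator `D_glob + 𝓜`, with domain `D(D_glob)`. -/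
def dArith {K : Type*} [NormedAddCommGroup K] [InnerProductSpace ℂ K]
    (W : L2X ≃ₗᵢ[ℂ] HilbertTensor L2R K) (U : ℝ → ℝ) (Estar : ℝ) (Φ₀ : L2X)
    (T : PrimeNumber → HPhys Φ₀ →L[ℂ] HPhys Φ₀) (η : PrimeNumber → ℝ → ℝ) :
    Double (HPhys Φ₀) →ₗ.[ℂ] Double (HPhys Φ₀) :=
  (massOperator T η : Double (HPhys Φ₀) →ₗ[ℂ] Double (HPhys Φ₀)) +ᵥ dGlobPhys W U Estar Φ₀

end AdelicDirac

end

/-! Everything reduces to one fact: `D_glob` is self-adjoint in the physical space. A bounded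
symmetric perturbation then keeps self-adjointness and the domain, and a compact one keeps the
essential spectrum (Weyl).

For `D_glob` the chain starts with `-d²/dy²` on `H²(ℝ)`. Since `u' = ±u` has no nonzero solution in
`L²(ℝ)`, test functions are dense in `H¹(ℝ)`. This gives integration by parts, hence symmetry, while
projecting `(k, 0)` onto the closed graph `{(f, f')}` solves `-f'' + f = k`. A symmetric operator
with surjective shifts is self-adjoint (`isSelfAdjoint_of_surjective`). A continuous periodic `U` is
bounded, so `Q_∞` is a bounded symmetric perturbation of it. Self-adjointness passes to the block
matrix, to `D ⊗ I` (the ranges of `D ⊗ I ± i` contain all pure tensors), and to the part in a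
reducing subspace.

The mass terms satisfy `‖η_p(T_p)‖ ≤ ‖η_p‖_∞`, because a symmetric operator has norm equal to the
supremum of its Rayleigh quotient and spectral measures have mass at most `‖x‖²`. So the series
converges absolutely.

For Weyl's theorem a closed operator is viewed as a bounded operator on its graph, where a compact
perturbation is a small one modulo finite rank (`isFredholm_add_compact`). -/

noncomputable section

namespace AdelicDirac

/-! ### Self-adjointness through graphs and bounded perturbations. -/

section Operators

variable {E : Type*} [NormedAddCommGroup E] [InnerProductSpace ℂ E]

/-- A linear relation in `E × E` is symmetric if it is contained in its adjoint. -/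
def IsSymmetricRel (G : Submodule ℂ (E × E)) : Prop :=
  ∀ p ∈ G, ∀ q ∈ G, ⟪p.2, q.1⟫_ℂ = ⟪p.1, q.2⟫_ℂ

/-- Working with pairs in the graph avoids carrying domain membership proofs. Density is kept as a
separate clause because the adjoint relation is the graph of an operator only for a dense domain. -/
theorem isSelfAdjoint_iff_graph [CompleteSpace E] {A : E →ₗ.[ℂ] E} :
    IsSelfAdjoint A ↔ Dense (A.domain : Set E) ∧ A.graph.adjoint = A.graph := by
  constructor
  · intro h
    refine ⟨h.dense_domain, ?_⟩
    rw [← LinearPMap.adjoint_graph_eq_graph_adjoint h.dense_domain, LinearPMap.isSelfAdjoint_def.1 h]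
  · rintro ⟨hd, h⟩
    rw [LinearPMap.isSelfAdjoint_def]
    refine LinearPMap.eq_of_eq_graph ?_
    rw [LinearPMap.adjoint_graph_eq_graph_adjoint hd, h]

theorem mem_adjoint_iff' (G : Submodule ℂ (E × E)) (x : E × E) :
    x ∈ G.adjoint ↔ ∀ p ∈ G, ⟪p.2, x.1⟫_ℂ = ⟪p.1, x.2⟫_ℂ := by
  rw [Submodule.mem_adjoint_iff]
  simp only [sub_eq_zero, Prod.forall]

theorem _root_.IsSelfAdjoint.isSymmetricRel_graph [CompleteSpace E] {A : E →ₗ.[ℂ] E}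
    (hA : IsSelfAdjoint A) : IsSymmetricRel A.graph := by
  intro p hp q hq
  rw [← (isSelfAdjoint_iff_graph.1 hA).2] at hq
  exact (mem_adjoint_iff' _ _).1 hq p hp

theorem mem_graph_of_forall [CompleteSpace E] {A : E →ₗ.[ℂ] E} (hA : IsSelfAdjoint A) {x : E × E}
    (h : ∀ p ∈ A.graph, ⟪p.2, x.1⟫_ℂ = ⟪p.1, x.2⟫_ℂ) : x ∈ A.graph := by
  rw [← (isSelfAdjoint_iff_graph.1 hA).2]
  exact (mem_adjoint_iff' _ _).2 h

theorem dense_of_forall_inner [CompleteSpace E] (S : Submodule ℂ E)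
    (h : ∀ v : E, (∀ a ∈ S, ⟪a, v⟫_ℂ = 0) → v = 0) : Dense (S : Set E) := by
  rw [Submodule.dense_iff_topologicalClosure_eq_top, Submodule.topologicalClosure_eq_top_iff,
    Submodule.eq_bot_iff]
  intro v hv
  exact h v fun a ha => (Submodule.mem_orthogonal _ _).1 hv a ha

/-- A symmetric operator `A` with `A + c` and `A + c̄` surjective is self-adjoint. -/
theorem isSelfAdjoint_of_surjective [CompleteSpace E] {A : E →ₗ.[ℂ] E}
    (hs : IsSymmetricRel A.graph) (c : ℂ) (h1 : ∀ z, ∃ p ∈ A.graph, p.2 + c • p.1 = z)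
    (h2 : ∀ z, ∃ p ∈ A.graph, p.2 + (starRingEnd ℂ) c • p.1 = z) : IsSelfAdjoint A := by
  -- A vector orthogonal to the range of `A + c̄` is zero, as that range is everything.
  have key : ∀ u : E, (∀ p ∈ A.graph, ⟪p.2 + (starRingEnd ℂ) c • p.1, u⟫_ℂ = 0) → u = 0 := by
    intro u hu
    obtain ⟨p, hp, hpu⟩ := h2 u
    have := hu p hp
    rw [hpu] at this
    exact inner_self_eq_zero.1 this
  rw [isSelfAdjoint_iff_graph]
  constructor
  · refine dense_of_forall_inner _ fun v hv => ?_
    -- With `v = A p₁ + c p₁` orthogonal to the domain, symmetry turns `⟪q₁, v⟫ = 0` into `⟪A q₁ +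
    -- c̄ q₁, p₁⟫ = 0`, so `p₁ = 0`.
    obtain ⟨p, hp, rfl⟩ := h1 v
    have h0 : p.1 = 0 := by
      refine key _ fun q hq => ?_
      have h3 := hv q.1 (LinearPMap.mem_domain_of_mem_graph (y := q.2) hq)
      rw [inner_add_right, inner_smul_right] at h3
      rw [inner_add_left, inner_smul_left, Complex.conj_conj, hs q hq p hp]
      exact h3
    rw [h0, smul_zero, add_zero]
    exact A.graph_fst_eq_zero_snd hp h0
  · refine le_antisymm (fun x hx => ?_) fun x hx => (mem_adjoint_iff' _ _).2 fun p hp => hs p hp x hx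
    rw [mem_adjoint_iff'] at hx
    -- An element `q` of the graph with the same image under the shift by `c`; then `x.1 - q.1` is
    -- orthogonal to the range of `A + c̄`, so `x = q`.
    obtain ⟨q, hq, hqx⟩ := h1 (x.2 + c • x.1)
    have hu : x.2 - q.2 = - (c • (x.1 - q.1)) := by
      rw [smul_sub, neg_sub, sub_eq_sub_iff_add_eq_add, ← hqx, add_comm]
    have h0 : x.1 - q.1 = 0 := by
      refine key _ fun p hp => ?_
      have h3 : ⟪p.2, x.1 - q.1⟫_ℂ = ⟪p.1, x.2 - q.2⟫_ℂ := by
        rw [inner_sub_right, inner_sub_right, hx p hp, hs p hp q hq]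
      rw [inner_add_left, inner_smul_left, Complex.conj_conj, h3, hu, inner_neg_right,
        inner_smul_right, neg_add_cancel]
    rw [h0, smul_zero, neg_zero] at hu
    rwa [Prod.ext (sub_eq_zero.1 h0) (sub_eq_zero.1 hu)]

/-- The cross term vanishes: symmetry makes `⟪p.2, p.1⟫` real, and `c` is purely imaginary. -/
theorem norm_sq_add_imaginary {G : Submodule ℂ (E × E)} (hs : IsSymmetricRel G) {c : ℂ}
    (hc : (starRingEnd ℂ) c = -c) (hc1 : ‖c‖ = 1) {p : E × E} (hp : p ∈ G) :
    ‖p.2 + c • p.1‖ ^ 2 = ‖p.2‖ ^ 2 + ‖p.1‖ ^ 2 := by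
  have h1 : (⟪p.2, c • p.1⟫_ℂ).re = 0 := by
    have h2 := hs p hp p hp
    have h3 : (⟪p.2, p.1⟫_ℂ).im = 0 := by
      rw [← Complex.conj_eq_iff_im, inner_conj_symm, h2]
    have h4 : c.re = 0 := by
      have := congrArg Complex.re hc
      simp at this
      linarith
    rw [inner_smul_right, Complex.mul_re, h3, h4]
    simp
  have h5 := norm_add_sq (𝕜 := ℂ) p.2 (c • p.1)
  rw [h5, norm_smul, hc1, one_mul]
  simp [h1]

/-- For a closed symmetric relation `G`, the range of `G + c` with `c = ± i` is closed. -/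
theorem surjective_of_denseRange [CompleteSpace E] {G : Submodule ℂ (E × E)}
    (hG : IsClosed (G : Set (E × E))) (hs : IsSymmetricRel G) {c : ℂ}
    (hc : (starRingEnd ℂ) c = -c) (hc1 : ‖c‖ = 1)
    (hd : ∀ v : E, (∀ p ∈ G, ⟪p.2 + c • p.1, v⟫_ℂ = 0) → v = 0) (z : E) :
    ∃ p ∈ G, p.2 + c • p.1 = z := by
  let L : G →L[ℂ] E := (ContinuousLinearMap.snd ℂ E E + c • ContinuousLinearMap.fst ℂ E E) ∘L
    G.subtypeL
  have hL : ∀ p : G, L p = p.1.2 + c • p.1.1 := fun p => rfl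
  have hcs : CompleteSpace G := hG.completeSpace_coe
  -- By `norm_sq_add_imaginary`, `L` dominates both components, hence the sup norm of the product; a
  -- map bounded below on a complete space has closed range.
  have ha : AntilipschitzWith 1 L := by
    refine L.antilipschitz_of_bound fun p => ?_
    have := norm_sq_add_imaginary hs hc hc1 p.2
    rw [hL, NNReal.coe_one, one_mul]
    refine (max_le ?_ ?_ : max ‖p.1.1‖ ‖p.1.2‖ ≤ _)
    · exact le_of_sq_le_sq (by nlinarith [sq_nonneg ‖p.1.2‖]) (norm_nonneg _)
    · exact le_of_sq_le_sq (by nlinarith [sq_nonneg ‖p.1.1‖]) (norm_nonneg _)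
  have hcl : IsClosed (Set.range L) := ha.isClosed_range L.uniformContinuous
  have hde : Dense ((LinearMap.range L.toLinearMap : Submodule ℂ E) : Set E) := by
    refine dense_of_forall_inner _ fun v hv => hd v fun p hp => ?_
    exact hv _ ⟨⟨p, hp⟩, rfl⟩
  have hu : Set.range L = univ := by
    rw [← hcl.closure_eq]
    exact hde.closure_eq
  obtain ⟨p, hp⟩ := (Set.range_eq_univ.1 hu) z
  exact ⟨p.1, p.2, hp⟩

/-- For self-adjoint `A` the operators `A ± i` are surjective. -/
theorem _root_.IsSelfAdjoint.surjective_add_imaginary [CompleteSpace E] {A : E →ₗ.[ℂ] E}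
    (hA : IsSelfAdjoint A) {c : ℂ} (hc : (starRingEnd ℂ) c = -c) (hc1 : ‖c‖ = 1) (z : E) :
    ∃ p ∈ A.graph, p.2 + c • p.1 = z := by
  have hs := hA.isSymmetricRel_graph
  refine surjective_of_denseRange hA.isClosed hs hc hc1 (fun v hv => ?_) z
  have hm : (v, c • v) ∈ A.graph := by
    refine mem_graph_of_forall hA fun p hp => ?_
    have := hv p hp
    rw [inner_add_left, inner_smul_left, hc] at this
    rw [inner_smul_right]
    linear_combination this
  have h2 := hs _ hm _ hm
  simp only [inner_smul_left, inner_smul_right, hc] at h2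
  have hc0 : c ≠ 0 := norm_ne_zero_iff.1 (by rw [hc1]; exact one_ne_zero)
  have h3 : (2 * c) * ⟪v, v⟫_ℂ = 0 := by linear_combination -h2
  rcases mul_eq_zero.1 h3 with h | h
  · exact absurd h (mul_ne_zero two_ne_zero hc0)
  · exact inner_self_eq_zero.1 h

theorem mem_graph_vadd (B : E →ₗ[ℂ] E) (A : E →ₗ.[ℂ] E) (p : E × E) :
    p ∈ (B +ᵥ A).graph ↔ (p.1, p.2 - B p.1) ∈ A.graph := by
  simp only [LinearPMap.mem_graph_iff]
  constructor
  · rintro ⟨y, h1, h2⟩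
    refine ⟨y, h1, ?_⟩
    rw [← h2, ← h1, LinearPMap.vadd_apply]
    simp
  · rintro ⟨y, h1, h2⟩
    refine ⟨y, h1, ?_⟩
    rw [LinearPMap.vadd_apply]
    change B y + A y = p.2
    rw [h2, h1]
    simp

/-- A bounded self-adjoint perturbation of a self-adjoint operator is self-adjoint. -/
theorem _root_.IsSelfAdjoint.bounded_vadd [CompleteSpace E] {A : E →ₗ.[ℂ] E} (hA : IsSelfAdjoint A)
    {B : E →ₗ[ℂ] E} (hB : B.IsSymmetric) : IsSelfAdjoint (B +ᵥ A) := by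
  rw [isSelfAdjoint_iff_graph]
  refine ⟨hA.dense_domain, ?_⟩
  ext x
  rw [mem_adjoint_iff', mem_graph_vadd]
  constructor
  · intro h
    refine mem_graph_of_forall hA fun p hp => ?_
    have h1 := h (p.1, p.2 + B p.1) ((mem_graph_vadd _ _ _).2 (by simpa using hp))
    simp only [inner_add_left] at h1
    rw [inner_sub_right, ← h1, hB]
    ring
  · intro h p hp
    have h1 := hA.isSymmetricRel_graph _ ((mem_graph_vadd _ _ _).1 hp) _ h
    simp only [inner_sub_left, inner_sub_right] at h1
    have h2 := hB p.1 x.1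
    linear_combination h1 + h2

/-! ### Off-diagonal matrices and parts in reducing subspaces. -/

theorem inner_double (x y : Double E) : ⟪x, y⟫_ℂ = ⟪x.fst, y.fst⟫_ℂ + ⟪x.snd, y.snd⟫_ℂ := rfl

theorem mem_graph_chiral (A : E →ₗ.[ℂ] E) (p : Double E × Double E) :
    p ∈ (chiral A).graph ↔ (p.1.fst, p.2.snd) ∈ A.graph ∧ (p.1.snd, p.2.fst) ∈ A.graph := by
  simp only [LinearPMap.mem_graph_iff]
  constructor
  · rintro ⟨y, h1, h2⟩
    rw [← h1, ← h2]
    exact ⟨⟨⟨y.1.fst, y.2.1⟩, rfl, rfl⟩, ⟨⟨y.1.snd, y.2.2⟩, rfl, rfl⟩⟩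
  · rintro ⟨⟨y, h1, h2⟩, ⟨z, h3, h4⟩⟩
    refine ⟨⟨p.1, ?_⟩, rfl, ?_⟩
    · constructor
      · change p.1.fst ∈ A.domain
        exact h1 ▸ y.2
      · change p.1.snd ∈ A.domain
        exact h3 ▸ z.2
    · refine WithLp.ofLp_injective 2 (Prod.ext ?_ ?_)
      · refine Eq.trans ?_ h4
        exact congrArg A (Subtype.ext h3.symm)
      · refine Eq.trans ?_ h2
        exact congrArg A (Subtype.ext h1.symm)

/-- Testing the adjoint relation on vectors with one zero component splits it into two adjoint
relations for `A`. -/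
theorem isSelfAdjoint_chiral [CompleteSpace E] {A : E →ₗ.[ℂ] E} (hA : IsSelfAdjoint A) :
    IsSelfAdjoint (chiral A) := by
  have hz : ((0 : E), (0 : E)) ∈ A.graph := A.graph.zero_mem
  rw [isSelfAdjoint_iff_graph]
  constructor
  · have h := (hA.dense_domain.prod hA.dense_domain).preimage
      (WithLp.prodContinuousLinearEquiv 2 ℂ E E).toHomeomorph.isOpenMap
    exact h
  · ext x
    rw [mem_adjoint_iff', mem_graph_chiral]
    constructor
    · intro h
      constructor
      · refine mem_graph_of_forall hA fun p hp => ?_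
        have := h (WithLp.toLp 2 (0, p.1), WithLp.toLp 2 (p.2, 0))
          ((mem_graph_chiral _ _).2 ⟨hz, hp⟩)
        simpa [inner_double] using this
      · refine mem_graph_of_forall hA fun p hp => ?_
        have := h (WithLp.toLp 2 (p.1, 0), WithLp.toLp 2 (0, p.2))
          ((mem_graph_chiral _ _).2 ⟨hp, hz⟩)
        simpa [inner_double] using this
    · rintro ⟨h1, h2⟩ p hp
      obtain ⟨h3, h4⟩ := (mem_graph_chiral _ _).1 hp
      have e1 := hA.isSymmetricRel_graph _ h4 _ h1
      have e2 := hA.isSymmetricRel_graph _ h3 _ h2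
      simp only at e1 e2
      rw [inner_double, inner_double, e1, e2, add_comm]

theorem graph_part {F : Type*} [NormedAddCommGroup F] [InnerProductSpace ℂ F] {J : F →L[ℂ] E}
    (hJ : Function.Injective J) (D : E →ₗ.[ℂ] E) :
    (part J D).graph = D.graph.comap (J.prodMap J).toLinearMap := by
  refine Submodule.toLinearPMap_graph_eq _ fun x hx h0 => hJ ?_
  rw [map_zero]
  refine D.graph_fst_eq_zero_snd (x := J x.1) hx ?_
  rw [h0, map_zero]

/-- The part of a self-adjoint operator in a reducing subspace is self-adjoint; `J` is the isometric
inclusion of the subspace and `P` its adjoint. -/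
theorem isSelfAdjoint_part [CompleteSpace E] {F : Type*} [NormedAddCommGroup F]
    [InnerProductSpace ℂ F] [CompleteSpace F] {J : F →L[ℂ] E} {P : E →L[ℂ] F} {D : E →ₗ.[ℂ] E}
    (hD : IsSelfAdjoint D) (hP : ∀ x y, ⟪P x, y⟫_ℂ = ⟪x, J y⟫_ℂ) (hPJ : ∀ x, P (J x) = x)
    (hred : IsReducedBy (J ∘L P) D) : IsSelfAdjoint (part J D) := by
  have hinj : Function.Injective J := Function.LeftInverse.injective hPJ
  have hg : ∀ p : F × F, p ∈ (part J D).graph ↔ (J p.1, J p.2) ∈ D.graph := fun p => by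
    rw [graph_part hinj]
    rfl
  -- This is where reduction enters: `P` carries the graph of `D` into the graph of the part. It
  -- gives density of the domain and lets test pairs in `D.graph` replace those of the part.
  have hadj : ∀ p ∈ D.graph, (P p.1, P p.2) ∈ (part J D).graph := by
    intro p hp
    rw [hg]
    obtain ⟨y, h1, h2⟩ := (LinearPMap.mem_graph_iff _).1 hp
    obtain ⟨h3, h4⟩ := hred y
    rw [LinearPMap.mem_graph_iff]
    refine ⟨_, ?_, h4.trans ?_⟩
    · simp [h1]
    · simp [h2]
  rw [isSelfAdjoint_iff_graph]
  constructor
  · have hr : DenseRange P := (Function.RightInverse.surjective hPJ).denseRange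
    refine (hr.dense_image P.continuous hD.dense_domain).mono ?_
    rintro _ ⟨x, hx, rfl⟩
    exact LinearPMap.mem_domain_of_mem_graph (hadj _ (D.mem_graph ⟨x, hx⟩))
  · ext x
    rw [mem_adjoint_iff', hg]
    constructor
    · intro h
      refine mem_graph_of_forall hD fun p hp => ?_
      rw [← hP, ← hP]
      exact h _ (hadj p hp)
    · intro h p hp
      have := hD.isSymmetricRel_graph _ h _ ((hg p).1 hp)
      rw [← hP, ← hP, hPJ, hPJ] at this
      rw [← inner_conj_symm p.2, ← inner_conj_symm p.1, ← this]

/-! ### The operator `D ⊗ I`. -/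

variable {K H : Type*} [NormedAddCommGroup K] [InnerProductSpace ℂ K]
  [NormedAddCommGroup H] [InnerProductSpace ℂ H]

theorem inner_pureTensor (W : H ≃ₗᵢ[ℂ] HilbertTensor E K) (ψ φ : Double E) (k l : K) :
    ⟪pureTensor W ψ k, pureTensor W φ l⟫_ℂ = ⟪ψ, φ⟫_ℂ * ⟪k, l⟫_ℂ := by
  simp [pureTensor, UniformSpace.Completion.inner_coe, add_mul]

theorem pureTensor_add_smul (W : H ≃ₗᵢ[ℂ] HilbertTensor E K) (ψ φ : Double E) (c : ℂ) (k : K) :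
    pureTensor W (ψ + c • φ) k = pureTensor W ψ k + c • pureTensor W φ k := by
  refine WithLp.ofLp_injective 2 (Prod.ext ?_ ?_) <;>
  simp [pureTensor, TensorProduct.add_tmul, UniformSpace.Completion.coe_add,
    ← TensorProduct.smul_tmul', UniformSpace.Completion.coe_smul]

theorem eq_zero_of_inner_tmul {v : HilbertTensor E K}
    (h : ∀ (x : E) (k : K), ⟪((x ⊗ₜ[ℂ] k : E ⊗[ℂ] K) : HilbertTensor E K), v⟫_ℂ = 0) : v = 0 := by
  have h1 : ∀ w : E ⊗[ℂ] K, ⟪(w : HilbertTensor E K), v⟫_ℂ = 0 := by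
    intro w
    induction w with
    | zero => rw [UniformSpace.Completion.coe_zero, inner_zero_left]
    | tmul x k => exact h x k
    | add a b ha hb => rw [UniformSpace.Completion.coe_add, inner_add_left, ha, hb, add_zero]
  have h2 : ∀ w : HilbertTensor E K, ⟪w, v⟫_ℂ = 0 := fun w =>
    UniformSpace.Completion.induction_on w
      (isClosed_eq (continuous_id.inner continuous_const) continuous_const) h1
  exact inner_self_eq_zero.1 (h2 v)

theorem eq_zero_of_inner_pureTensor (W : H ≃ₗᵢ[ℂ] HilbertTensor E K) {v : Double H}
    (h : ∀ (ψ : Double E) (k : K), ⟪pureTensor W ψ k, v⟫_ℂ = 0) : v = 0 := by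
  have key : ∀ u : H, (∀ (x : E) (k : K), ⟪W.symm ↑(x ⊗ₜ[ℂ] k), u⟫_ℂ = 0) → u = 0 := by
    intro u hu
    rw [← W.map_eq_zero_iff]
    refine eq_zero_of_inner_tmul fun x k => ?_
    rw [← hu x k, ← W.inner_map_map, W.apply_symm_apply]
  refine WithLp.ofLp_injective 2 (Prod.ext (key _ fun x k => ?_) (key _ fun x k => ?_))
  · simpa [inner_double, pureTensor, UniformSpace.Completion.coe_zero] using h (WithLp.toLp 2 (x, 0)) k
  · simpa [inner_double, pureTensor, UniformSpace.Completion.coe_zero] using h (WithLp.toLp 2 (0, x)) k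

/-- `D ⊗ I` is self-adjoint for self-adjoint `D`. -/
theorem isSelfAdjoint_tensorId [CompleteSpace E] [CompleteSpace H]
    (W : H ≃ₗᵢ[ℂ] HilbertTensor E K) {D : Double E →ₗ.[ℂ] Double E} (hD : IsSelfAdjoint D) :
    IsSelfAdjoint (tensorId W D) := by
  set S : Set (Double H × Double H) := Set.range fun q : D.domain × K =>
    (pureTensor W (q.1 : Double E) q.2, pureTensor W (D q.1) q.2) with hS
  set G := (Submodule.span ℂ S).topologicalClosure with hGdef
  have hmem : ∀ p ∈ D.graph, ∀ k : K, (pureTensor W p.1 k, pureTensor W p.2 k) ∈ G := by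
    intro p hp k
    obtain ⟨y, h1, h2⟩ := (LinearPMap.mem_graph_iff _).1 hp
    refine Submodule.le_topologicalClosure _ (Submodule.subset_span ⟨(y, k), ?_⟩)
    simp only [h1, h2]
  have hcl : IsClosed (G : Set (Double H × Double H)) := Submodule.isClosed_topologicalClosure _
  -- For fixed `q` the symmetry condition cuts out a closed subspace, so it may be checked on
  -- generators. Using this once in each variable gives symmetry of `G`.
  have hind : ∀ (q : Double H × Double H), (∀ p ∈ S, ⟪p.2, q.1⟫_ℂ = ⟪p.1, q.2⟫_ℂ) →
      ∀ p ∈ G, ⟪p.2, q.1⟫_ℂ = ⟪p.1, q.2⟫_ℂ := by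
    intro q hq
    let T : Submodule ℂ (Double H × Double H) :=
      { carrier := {p | ⟪p.2, q.1⟫_ℂ = ⟪p.1, q.2⟫_ℂ}
        zero_mem' := by simp
        add_mem' := fun {a b} ha hb => by
          have ha' : ⟪a.2, q.1⟫_ℂ = ⟪a.1, q.2⟫_ℂ := ha
          have hb' : ⟪b.2, q.1⟫_ℂ = ⟪b.1, q.2⟫_ℂ := hb
          change ⟪a.2 + b.2, q.1⟫_ℂ = ⟪a.1 + b.1, q.2⟫_ℂ
          rw [inner_add_left, inner_add_left, ha', hb']
        smul_mem' := fun c a ha => by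
          have ha' : ⟪a.2, q.1⟫_ℂ = ⟪a.1, q.2⟫_ℂ := ha
          change ⟪c • a.2, q.1⟫_ℂ = ⟪c • a.1, q.2⟫_ℂ
          rw [inner_smul_left, inner_smul_left, ha'] }
    have hT : G ≤ T := by
      refine Submodule.topologicalClosure_minimal _ (Submodule.span_le.2 hq) ?_
      exact isClosed_eq (continuous_snd.inner continuous_const)
        (continuous_fst.inner continuous_const)
    exact fun p hp => hT hp
  have hswap : ∀ p q : Double H × Double H,
      ⟪p.2, q.1⟫_ℂ = ⟪p.1, q.2⟫_ℂ → ⟪q.2, p.1⟫_ℂ = ⟪q.1, p.2⟫_ℂ := by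
    intro p q h
    rw [← inner_conj_symm q.2, ← h, inner_conj_symm]
  have hsym : IsSymmetricRel G := by
    intro p hp q hq
    refine hind q (fun p hp => hswap _ _ (hind p (fun q hq => ?_) q hq)) p hp
    obtain ⟨⟨x, k⟩, rfl⟩ := hp
    obtain ⟨⟨y, l⟩, rfl⟩ := hq
    simp only [inner_pureTensor]
    have := hD.isSymmetricRel_graph _ (D.mem_graph y) _ (D.mem_graph x)
    simp only at this
    rw [this]
  have hrange : ∀ c : ℂ, (starRingEnd ℂ) c = -c → ‖c‖ = 1 → ∀ z, ∃ p ∈ G, p.2 + c • p.1 = z := by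
    intro c hc hc1
    refine surjective_of_denseRange hcl hsym hc hc1 fun v hv => ?_
    refine eq_zero_of_inner_pureTensor W fun ψ k => ?_
    -- As `D + c` is onto, every pure tensor is `(D p₁ + c p₁) ⊗ k`, hence lies in the range of `G +
    -- c`.
    obtain ⟨p, hp, rfl⟩ := hD.surjective_add_imaginary hc hc1 ψ
    rw [pureTensor_add_smul]
    exact hv _ (hmem p hp k)
  -- Closability: if `(0, x₂)` is in `G`, symmetry makes `x₂` orthogonal to `ψ ⊗ k` for `ψ` in the
  -- dense domain of `D`, then for all `ψ` by continuity.
  have hsv : ∀ x ∈ G, x.1 = 0 → x.2 = 0 := by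
    intro x hx h0
    refine eq_zero_of_inner_pureTensor W fun ψ k => ?_
    have hcl' : IsClosed {ψ : Double E | ⟪pureTensor W ψ k, x.2⟫_ℂ = 0} := by
      refine isClosed_eq (Continuous.inner ?_ continuous_const) continuous_const
      have h1 : Continuous fun ψ : E => W.symm ((ψ ⊗ₜ[ℂ] k : E ⊗[ℂ] K) : HilbertTensor E K) := by
        refine W.symm.continuous.comp ((UniformSpace.Completion.continuous_coe _).comp ?_)
        exact ((TensorProduct.mk ℂ E K).flip k).mkContinuous ‖k‖
          (fun x => by simp [mul_comm]) |>.continuous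
      exact (WithLp.prod_continuous_toLp _ _ _).comp
        ((h1.comp (WithLp.fstL 2 ℂ E E).continuous).prodMk
          (h1.comp (WithLp.sndL 2 ℂ E E).continuous))
    refine hcl'.closure_subset_iff.2 (fun ψ hψ => ?_) (hD.dense_domain ψ)
    have := hsym _ (hmem _ (D.mem_graph ⟨ψ, hψ⟩) k) x hx
    rw [h0, inner_zero_right] at this
    exact this.symm
  have hgraph : (tensorId W D).graph = G := Submodule.toLinearPMap_graph_eq _ hsv
  refine isSelfAdjoint_of_surjective (by rwa [hgraph]) Complex.I ?_ ?_
  · rw [hgraph]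
    exact hrange _ Complex.conj_I Complex.norm_I
  · rw [hgraph]
    exact hrange _ (by simp) (by simp)

end Operators

/-! ### Fredholm operators and Weyl's theorem. -/

section Fredholm

open ContinuousLinearMap
open scoped LinearMap.FiniteRangeSetoid

/-- Compact operators into a Hilbert space are norm limits of operators of finite rank. -/
theorem exists_finiteRange_norm_sub_le {X F : Type*} [NormedAddCommGroup X] [NormedSpace ℂ X]
    [NormedAddCommGroup F] [InnerProductSpace ℂ F] {k : X →L[ℂ] F} (hk : IsCompactOperator k)
    {ε : ℝ} (hε : 0 < ε) :
    ∃ f : X →L[ℂ] F, f.toLinearMap.HasFiniteRange ∧ ‖k - f‖ ≤ ε := by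
  obtain ⟨C, hC, hCk⟩ := hk.image_closedBall_subset_compact (f := k.toLinearMap) 1
  obtain ⟨t, -, htf, ht⟩ := Metric.totallyBounded_iff.1 hC.totallyBounded ε hε |>.imp
    fun t h => (⟨trivial, h.1, h.2⟩ : True ∧ _ ∧ _)
  -- The span of a finite `ε`-net for the image of the unit ball. Projecting to `V` gives the
  -- nearest point of `V`, so it moves that image by at most `ε`.
  let V : Submodule ℂ F := Submodule.span ℂ t
  have hV : FiniteDimensional ℂ V := FiniteDimensional.span_of_finite ℂ htf
  refine ⟨V.starProjection ∘L k, ?_, ?_⟩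
  · have h1 : (V.starProjection : F →L[ℂ] F).toLinearMap.HasFiniteRange := by
      rw [LinearMap.hasFiniteRange_iff_range, Submodule.range_starProjection]
      exact (Submodule.fg_iff_finiteDimensional _).2 hV
    exact h1.comp_right k.toLinearMap
  · refine opNorm_le_of_unit_norm hε.le fun x hx => ?_
    have hx' : k x ∈ C := hCk ⟨x, by simp [hx], rfl⟩
    obtain ⟨y, hy, hxy⟩ := mem_iUnion₂.1 (ht hx')
    have h1 : ‖k x - V.starProjection (k x)‖ ≤ ‖k x - y‖ := by
      rw [Submodule.starProjection_minimal]
      exact ciInf_le ⟨0, by rintro _ ⟨w, rfl⟩; exact norm_nonneg _⟩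
        (⟨y, Submodule.subset_span hy⟩ : V)
    refine h1.trans ?_
    rw [← dist_eq_norm]
    exact (Metric.mem_ball.1 hxy).le

/-- A compact perturbation of a Fredholm operator is Fredholm. -/
theorem isFredholm_add_compact {X F : Type*} [NormedAddCommGroup X] [NormedSpace ℂ X]
    [CompleteSpace X] [NormedAddCommGroup F] [InnerProductSpace ℂ F] [CompleteSpace F]
    {u k : X →L[ℂ] F} (hu : IsFredholm u) (hk : IsCompactOperator k) : IsFredholm (u + k) := by
  -- Let `v` invert `u` modulo finite rank, and split `k = f + s` with `f` of finite rank and `‖v‖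
  -- ‖s‖ < 1`. Modulo finite rank, `u + k` is `u + s`, while `v (u + s)` and `(u + s) v` are the
  -- invertible operators `a = 1 + v s` and `b = 1 + s v`.
  obtain ⟨v, hvu, huv⟩ := hu.exists_isQuasiInverse
  obtain ⟨f, hf, hs⟩ := exists_finiteRange_norm_sub_le hk
    (ε := (2 * (‖v‖ + 1))⁻¹) (by positivity)
  set s := k - f with hsdef
  have hlt : ‖v‖ * ‖s‖ < 1 := by
    calc ‖v‖ * ‖s‖ ≤ ‖v‖ * (2 * (‖v‖ + 1))⁻¹ := by gcongr
      _ < 1 := by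
        rw [← div_eq_mul_inv, div_lt_one (by positivity)]
        linarith [norm_nonneg v]
  obtain ⟨a, ha⟩ : IsUnit (1 - (-(v ∘L s))) := isUnit_one_sub_of_norm_lt_one (by
    rw [norm_neg]; exact (opNorm_comp_le _ _).trans_lt hlt)
  obtain ⟨b, hb⟩ : IsUnit (1 - (-(s ∘L v))) := isUnit_one_sub_of_norm_lt_one (by
    rw [norm_neg]; exact (opNorm_comp_le _ _).trans_lt (by rwa [mul_comm]))
  have hequiv : (u + k).toLinearMap ≈ (u + s).toLinearMap := by
    rw [LinearMap.FiniteRangeSetoid.equiv_iff_hasFiniteRange]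
    have : (u + k).toLinearMap - (u + s).toLinearMap = f.toLinearMap := by
      ext x
      simp [hsdef]
    rwa [this]
  have hleft : (v ∘L (u + s)).toLinearMap ≈ (a : X →L[ℂ] X).toLinearMap := by
    rw [LinearMap.FiniteRangeSetoid.equiv_iff_hasFiniteRange]
    have := LinearMap.FiniteRangeSetoid.equiv_iff_hasFiniteRange.1 hvu
    convert this using 1
    ext x
    simp [ha]
  have hright : ((u + s) ∘L v).toLinearMap ≈ (b : F →L[ℂ] F).toLinearMap := by
    rw [LinearMap.FiniteRangeSetoid.equiv_iff_hasFiniteRange]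
    have := LinearMap.FiniteRangeSetoid.equiv_iff_hasFiniteRange.1 huv
    convert this using 1
    ext x
    simp [hb]
  have ha1 : (↑a⁻¹ : X →L[ℂ] X).toLinearMap ∘ₗ (a : X →L[ℂ] X).toLinearMap = .id := by
    ext x
    exact DFunLike.congr_fun a.inv_mul x
  have hb1 : (b : F →L[ℂ] F).toLinearMap ∘ₗ (↑b⁻¹ : F →L[ℂ] F).toLinearMap = .id := by
    ext x
    exact DFunLike.congr_fun b.mul_inv x
  have h1 : ((↑a⁻¹ : X →L[ℂ] X).toLinearMap ∘ₗ v.toLinearMap) ∘ₗ (u + s).toLinearMap ≈ .id := by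
    have := LinearMap.FiniteRangeSetoid.equiv_comp_left (u' := (↑a⁻¹ : X →L[ℂ] X).toLinearMap) hleft
    rwa [ha1] at this
  have h2 : (u + s).toLinearMap ∘ₗ (v.toLinearMap ∘ₗ (↑b⁻¹ : F →L[ℂ] F).toLinearMap) ≈ .id := by
    have := LinearMap.FiniteRangeSetoid.equiv_comp_right (u := (↑b⁻¹ : F →L[ℂ] F).toLinearMap) hright
    rwa [hb1] at this
  -- The left inverse `a⁻¹ v` and the right inverse `v b⁻¹` agree modulo finite rank, by the usual
  -- associativity argument.
  have h3 : v.toLinearMap ∘ₗ (↑b⁻¹ : F →L[ℂ] F).toLinearMap ≈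
      (↑a⁻¹ : X →L[ℂ] X).toLinearMap ∘ₗ v.toLinearMap := by
    have e1 := LinearMap.FiniteRangeSetoid.equiv_comp_right
      (u := v.toLinearMap ∘ₗ (↑b⁻¹ : F →L[ℂ] F).toLinearMap) h1
    have e2 := LinearMap.FiniteRangeSetoid.equiv_comp_left
      (u' := (↑a⁻¹ : X →L[ℂ] X).toLinearMap ∘ₗ v.toLinearMap) h2
    rw [LinearMap.id_comp] at e1
    rw [LinearMap.comp_id] at e2
    exact Setoid.trans (Setoid.symm e1) e2
  refine IsFredholm.of_isQuasiInverse (v := ↑a⁻¹ ∘L v) (LinearMap.IsQuasiInverse.congr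
    (u := (↑a⁻¹ : X →L[ℂ] X).toLinearMap ∘ₗ v.toLinearMap) (v := (u + s).toLinearMap)
    ⟨h1, ?_⟩ (Setoid.refl _) hequiv)
  exact Setoid.trans (LinearMap.FiniteRangeSetoid.equiv_comp_left (Setoid.symm h3)) h2

/-- Strictness is the open mapping theorem onto the closed, hence complete, range; the kernel is
complemented because it is finite-dimensional. -/
theorem isFredholm_of_isClosed_range {X F : Type*} [NormedAddCommGroup X] [NormedSpace ℂ X]
    [CompleteSpace X] [NormedAddCommGroup F] [NormedSpace ℂ F] [CompleteSpace F]
    {u : X →L[ℂ] F} (h1 : FiniteDimensional ℂ u.toLinearMap.ker)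
    (h2 : IsClosed (u.toLinearMap.range : Set F))
    (h3 : FiniteDimensional ℂ (F ⧸ u.toLinearMap.range)) : IsFredholm u where
  isStrictMap := by
    have hc : CompleteSpace u.toLinearMap.range := h2.completeSpace_coe
    let w : X →L[ℂ] u.toLinearMap.range := u.codRestrict _ fun x => ⟨x, rfl⟩
    have hw : Function.Surjective w := by
      rintro ⟨_, x, rfl⟩
      exact ⟨x, rfl⟩
    exact (w.isOpenMap hw).isQuotientMap w.continuous hw
  isClosed_range := h2
  finite_ker := h1
  finite_coker := h3
  closedComplemented_ker := Submodule.ClosedComplemented.of_finiteDimensional _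

variable {E : Type*} [NormedAddCommGroup E] [InnerProductSpace ℂ E]

/-- The bounded operator `(x, A x) ↦ A x + B x - z x` on the graph of `A`. -/
def graphCLM (A : E →ₗ.[ℂ] E) (B : E →L[ℂ] E) (z : ℂ) : A.graph →L[ℂ] E :=
  (ContinuousLinearMap.snd ℂ E E + B ∘L ContinuousLinearMap.fst ℂ E E -
    z • ContinuousLinearMap.fst ℂ E E) ∘L A.graph.subtypeL

/-- The domain of an operator is linearly isomorphic to its graph. -/
def domainEquivGraph (A : E →ₗ.[ℂ] E) : A.domain ≃ₗ[ℂ] A.graph where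
  toFun x := ⟨(x, A x), A.mem_graph x⟩
  map_add' x y := Subtype.ext (Prod.ext rfl (A.map_add x y))
  map_smul' c x := Subtype.ext (Prod.ext rfl (A.map_smul c x))
  invFun p := ⟨p.1.1, LinearPMap.mem_domain_of_mem_graph p.2⟩
  left_inv x := rfl
  right_inv p := by
    obtain ⟨y, h1, h2⟩ := (LinearPMap.mem_graph_iff _).1 p.2
    refine Subtype.ext (Prod.ext rfl ?_)
    rw [← h2]
    exact congrArg A (Subtype.ext h1.symm)

/-- The graph of a closed operator is a Banach space on which the operator becomes bounded. Passing
from the domain to the graph preserves the range and, up to isomorphism, the kernel. -/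
theorem notMem_essSpectrum_iff [CompleteSpace E] {A : E →ₗ.[ℂ] E} (hA : A.IsClosed) (B : E →L[ℂ] E)
    (z : ℂ) : z ∉ essSpectrum ((B : E →ₗ[ℂ] E) +ᵥ A) ↔ IsFredholm (graphCLM A B z) := by
  have hcs : CompleteSpace A.graph :=
    (show _root_.IsClosed (A.graph : Set (E × E)) from hA).completeSpace_coe
  set L : A.domain →ₗ[ℂ] E := ((B : E →ₗ[ℂ] E) +ᵥ A).toFun -
    z • ((B : E →ₗ[ℂ] E) +ᵥ A).domain.subtype with hL
  have hcomp : L = (graphCLM A B z).toLinearMap ∘ₗ (domainEquivGraph A).toLinearMap := by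
    ext x
    change (B x + A x) - z • (x : E) = A x + B x - z • (x : E)
    rw [add_comm]
  have hr : LinearMap.range L = (graphCLM A B z).toLinearMap.range := by
    rw [hcomp]
    exact LinearMap.range_comp_of_range_eq_top _ (LinearEquiv.range _)
  have hk : FiniteDimensional ℂ (LinearMap.ker L) ↔
      FiniteDimensional ℂ (graphCLM A B z).toLinearMap.ker := by
    have e : LinearMap.ker L ≃ₗ[ℂ] (graphCLM A B z).toLinearMap.ker :=
      (domainEquivGraph A).ofSubmodules _ _ (by
        rw [hcomp, LinearMap.ker_comp]
        exact Submodule.map_comap_eq_of_surjective (domainEquivGraph A).surjective _)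
    exact ⟨fun h => Module.Finite.equiv e, fun h => Module.Finite.equiv e.symm⟩
  have hes : z ∉ essSpectrum ((B : E →ₗ[ℂ] E) +ᵥ A) ↔ (FiniteDimensional ℂ (LinearMap.ker L) ∧
      IsClosed (LinearMap.range L : Set E) ∧ FiniteDimensional ℂ (E ⧸ LinearMap.range L)) :=
    not_not
  rw [hes, hk, hr]
  exact ⟨fun h => isFredholm_of_isClosed_range h.1 h.2.1 h.2.2,
    fun h => ⟨h.finite_ker, h.isClosed_range, h.finite_coker⟩⟩

/-- Weyl's theorem: the essential spectrum of a closed operator is invariant under compact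
perturbations. -/
theorem essSpectrum_vadd_compact [CompleteSpace E] {A : E →ₗ.[ℂ] E} (hA : A.IsClosed)
    {B : E →L[ℂ] E} (hB : IsCompactOperator B) :
    essSpectrum ((B : E →ₗ[ℂ] E) +ᵥ A) = essSpectrum A := by
  have hcs : CompleteSpace A.graph :=
    (show _root_.IsClosed (A.graph : Set (E × E)) from hA).completeSpace_coe
  have hfst : IsCompactOperator (B ∘L ContinuousLinearMap.fst ℂ E E ∘L A.graph.subtypeL) :=
    hB.comp_clm (ContinuousLinearMap.fst ℂ E E ∘L A.graph.subtypeL)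
  -- Writing `A` as `0 + A` lets one criterion on the same graph treat both operators.
  have h0 : ((0 : E →L[ℂ] E) : E →ₗ[ℂ] E) +ᵥ A = A := by
    rw [ContinuousLinearMap.toLinearMap_zero, zero_vadd]
  ext z
  rw [← not_iff_not]
  nth_rewrite 2 [← h0]
  rw [notMem_essSpectrum_iff hA, notMem_essSpectrum_iff hA]
  set k := B ∘L ContinuousLinearMap.fst ℂ E E ∘L A.graph.subtypeL with hk
  have e1 : graphCLM A 0 z = graphCLM A B z + -k := by
    ext x
    simp [graphCLM, hk]
    abel
  have e2 : graphCLM A B z = graphCLM A 0 z + k := by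
    ext x
    simp [graphCLM, hk]
    abel
  constructor
  · intro h
    rw [e1]
    exact isFredholm_add_compact h hfst.neg
  · intro h
    rw [e2]
    exact isFredholm_add_compact h hfst

end Fredholm

/-! ### Weak solutions of `f' = ±f` in `L²(ℝ)`. -/

section WeakDerivative

/-- A test function of integral zero is the derivative of a test function. -/
theorem exists_primitive_of_integral_eq_zero {h : ℝ → ℂ} (hh : ContDiff ℝ ∞ h)
    (hs : HasCompactSupport h) (h0 : ∫ t, h t = 0) :
    ∃ G : ℝ → ℂ, ContDiff ℝ ∞ G ∧ HasCompactSupport G ∧ ∀ x, HasDerivAt G (h x) x := by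
  obtain ⟨R, hR0, hR⟩ : ∃ R : ℝ, 0 < R ∧ ∀ t, R ≤ |t| → h t = 0 := by
    obtain ⟨R, hR⟩ := hs.isCompact.isBounded.subset_closedBall 0
    refine ⟨|R| + 1, by positivity, fun t ht => image_eq_zero_of_notMem_tsupport fun h1 => ?_⟩
    have h2 := mem_closedBall_zero_iff.1 (hR h1)
    rw [Real.norm_eq_abs] at h2
    linarith [le_abs_self R]
  have hd : ∀ x, HasDerivAt (fun x => ∫ t in (-R)..x, h t) (h x) x := fun x =>
    intervalIntegral.integral_hasDerivAt_right (hh.continuous.intervalIntegrable _ _)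
      (hh.continuous.stronglyMeasurableAtFilter _ _) hh.continuous.continuousAt
  refine ⟨fun x => ∫ t in (-R)..x, h t, ?_, ?_, hd⟩
  · rw [contDiff_infty_iff_deriv]
    refine ⟨fun x => (hd x).differentiableAt, ?_⟩
    rwa [show deriv (fun x => ∫ t in (-R)..x, h t) = h from funext fun x => (hd x).deriv]
  · refine HasCompactSupport.intro (isCompact_Icc (a := -R) (b := R)) fun x hx => ?_
    rcases lt_or_ge x (-R) with h1 | h1
    · refine intervalIntegral.integral_zero_ae (Eventually.of_forall fun t ht => hR t ?_)
      rw [uIoc_of_ge h1.le] at ht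
      rw [abs_of_neg (by linarith [ht.2])]
      linarith [ht.2]
    · have h2 : R < x := by
        by_contra h3
        exact hx ⟨h1, not_lt.1 h3⟩
      -- To the right of the support the primitive equals the full integral of `h`, which is zero.
      rw [← h0]
      refine intervalIntegral.integral_eq_integral_of_support_subset fun t ht => ?_
      have h3 : |t| < R := not_le.1 fun h4 => ht (hR t h4)
      rw [abs_lt] at h3
      exact ⟨h3.1, by linarith⟩

theorem contDiff_cexp_mul (c : ℝ) : ContDiff ℝ ∞ fun t : ℝ => Complex.exp ((c * t : ℝ) : ℂ) :=
  (Complex.ofRealCLM.contDiff.comp (contDiff_const.mul contDiff_id)).cexp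

theorem hasDerivAt_cexp_mul (c x : ℝ) :
    HasDerivAt (fun t : ℝ => Complex.exp ((c * t : ℝ) : ℂ)) (Complex.exp ((c * x : ℝ) : ℂ) * c) x := by
  have h1 : HasDerivAt (fun t : ℝ => c * t) c x := by
    simpa using (hasDerivAt_id x).const_mul c
  exact h1.ofReal_comp.cexp

/-- The translation relation satisfied by square integrable weak solutions of `f' = ε f`. -/
theorem IsWeakDeriv.integral_eq_translate {f : L2R} {ε : ℝ} (hf : IsWeakDeriv f ((ε : ℂ) • f))
    {ψ : ℝ → ℂ} (hψ : ContDiff ℝ ∞ ψ) (hs : HasCompactSupport ψ) (s : ℝ) :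
    ∫ y, f y * ψ y = Complex.exp ((-ε * s : ℝ) : ℂ) * ∫ y, f y * ψ (y - s) := by
  have hψs : ContDiff ℝ ∞ fun y => ψ (y - s) := hψ.comp (contDiff_id.sub contDiff_const)
  have hss : HasCompactSupport fun y => ψ (y - s) :=
    hs.comp_homeomorph (Homeomorph.subRight s)
  set c : ℂ := Complex.exp ((-ε * s : ℝ) : ℂ) with hc
  set e : ℝ → ℂ := fun t => Complex.exp ((ε * t : ℝ) : ℂ) with he
  set e' : ℝ → ℂ := fun t => Complex.exp ((-ε * t : ℝ) : ℂ) with he'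
  have hee : ∀ t, e' t * e t = 1 := fun t => by
    simp only [he, he', ← Complex.exp_add]
    simp
  -- The two terms of `h` are translates of one function, so `h` has integral zero and a compactly
  -- supported primitive `G`. Then `φ = e' G` solves `φ' + ε φ = ψ - c ψ(· - s)`, and `f`
  -- annihilates the left side.
  let h : ℝ → ℂ := fun t => e t * (ψ t - c * ψ (t - s))
  have hh : ContDiff ℝ ∞ h := (contDiff_cexp_mul ε).mul (hψ.sub (contDiff_const.mul hψs))
  have hhs : HasCompactSupport h := (hs.sub (hss.mul_left (f := fun _ => c))).mul_left
  have hi : ∀ {g : ℝ → ℂ}, Continuous g → HasCompactSupport g → Integrable g := fun hg hgs =>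
    hg.integrable_of_hasCompactSupport hgs
  have hce : ∀ t, e t * c = e (t - s) := fun t => by
    simp only [he, hc, ← Complex.exp_add]
    push_cast
    ring_nf
  have h0 : ∫ t, h t = 0 := by
    have h1 : ∀ t, h t = e t * ψ t - e (t - s) * ψ (t - s) := fun t => by
      rw [← hce]
      simp only [h]
      ring
    have hce' : Continuous e := (contDiff_cexp_mul ε).continuous
    have hint : Integrable fun t => e t * ψ t := hi (hce'.mul hψ.continuous) hs.mul_left
    simp_rw [h1]
    rw [integral_sub hint (hint.comp_sub_right s),
      integral_sub_right_eq_self (fun t => e t * ψ t), sub_self]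
  obtain ⟨G, hG, hGs, hGd⟩ := exists_primitive_of_integral_eq_zero hh hhs h0
  have hφ : ContDiff ℝ ∞ fun t => e' t * G t := (contDiff_cexp_mul (-ε)).mul hG
  have hφs : HasCompactSupport fun t => e' t * G t := hGs.mul_left
  have hd : ∀ x, deriv (fun t => e' t * G t) x =
      ψ x - c * ψ (x - s) - ε * (e' x * G x) := fun x => by
    have h1 : HasDerivAt (fun t => e' t * G t)
        (e' x * ((-ε : ℝ) : ℂ) * G x + e' x * h x) x := (hasDerivAt_cexp_mul (-ε) x).mul (hGd x)
    rw [h1.deriv]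
    have := hee x
    simp only [h, Complex.ofReal_neg]
    linear_combination (ψ x - c * ψ (x - s)) * this
  have h2 := hf _ hφ hφs
  have h3 : ∫ y, ((ε : ℂ) • f : L2R) y * (e' y * G y) = ∫ y, ε * (f y * (e' y * G y)) :=
    integral_congr_ae ((Lp.coeFn_smul (ε : ℂ) f).mono fun y hy => by
      simp only [hy, Pi.smul_apply, smul_eq_mul, mul_assoc])
  have h4 : ∫ y, f y * deriv (fun t => e' t * G t) y = (∫ y, f y * ψ y) -
      c * (∫ y, f y * ψ (y - s)) - ∫ y, ε * (f y * (e' y * G y)) := by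
    rw [← integral_const_mul, ← integral_sub, ← integral_sub]
    · refine integral_congr_ae (Eventually.of_forall fun y => ?_)
      simp only [hd]
      ring
    · exact (integrable_mul_test f hψ.continuous hs).sub
        ((integrable_mul_test f hψs.continuous hss).const_mul c)
    · exact (integrable_mul_test f hφ.continuous hφs).const_mul _
    · exact integrable_mul_test f hψ.continuous hs
    · exact (integrable_mul_test f hψs.continuous hss).const_mul c
  rw [h3, h4] at h2
  linear_combination h2

/-- `f' = ± f` has no nonzero weak solution in `L²(ℝ)`. -/
theorem IsWeakDeriv.eq_zero_of_eq_smul {f : L2R} {ε : ℝ} (hε : ε * ε = 1)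
    (hf : IsWeakDeriv f ((ε : ℂ) • f)) : f = 0 := by
  -- It suffices that `f` annihilates every test function, which is what zero having weak derivative
  -- `f` means.
  refine IsWeakDeriv.eq_zero fun ψ hψ hs => ?_
  have hz : ((0 : L2R) : ℝ → ℂ) =ᵐ[volume] 0 := Lp.coeFn_zero _ _ _
  rw [integral_congr_ae (g := fun _ => (0 : ℂ)) (hz.mono fun y _ => by simp), integral_zero,
    eq_comm, neg_eq_zero]
  set C : ℝ := (∫ y, ‖f y‖ ^ 2) + ∫ y, ‖ψ y‖ ^ 2 with hC
  have hf2 : Integrable fun y => ‖f y‖ ^ 2 := (Lp.memLp f).integrable_norm_pow two_ne_zero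
  have hψ2 : Integrable fun y => ‖ψ y‖ ^ 2 :=
    (hψ.continuous.memLp_of_hasCompactSupport (p := 2) hs).integrable_norm_pow two_ne_zero
  have hb : ∀ s, ‖∫ y, f y * ψ (y - s)‖ ≤ C := by
    intro s
    have h1 : ∫ y, ‖ψ y‖ ^ 2 = ∫ y, ‖ψ (y - s)‖ ^ 2 :=
      (integral_sub_right_eq_self (fun y => ‖ψ y‖ ^ 2) s).symm
    rw [hC, h1, ← integral_add hf2 (hψ2.comp_sub_right s)]
    refine norm_integral_le_of_norm_le (hf2.add (hψ2.comp_sub_right s))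
      (Eventually.of_forall fun y => ?_)
    rw [norm_mul]
    nlinarith [sq_nonneg (‖f y‖ - ‖ψ (y - s)‖), sq_nonneg ‖f y‖, sq_nonneg ‖ψ (y - s)‖]
  -- Translating by `ε n` produces the factor `exp (-ε² n) = exp (-n)`, while the translated
  -- integrals stay below `C`.
  have hb2 : ∀ n : ℕ, ‖∫ y, f y * ψ y‖ ≤ Real.exp (-(n : ℝ)) * C := by
    intro n
    rw [hf.integral_eq_translate hψ hs (ε * n), norm_mul, ← Complex.ofReal_exp, Complex.norm_real,
      Real.norm_of_nonneg (Real.exp_pos _).le,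
      show -ε * (ε * (n : ℝ)) = -(n : ℝ) by linear_combination (-(n : ℝ)) * hε]
    gcongr
    exact hb _
  have ht : Tendsto (fun n : ℕ => Real.exp (-(n : ℝ)) * C) atTop (𝓝 0) := by
    have := (Real.tendsto_exp_neg_atTop_nhds_zero.comp tendsto_natCast_atTop_atTop).mul_const C
    simpa using this
  exact norm_le_zero_iff.1 (ge_of_tendsto' ht hb2)

/-! ### The Sobolev space `H¹(ℝ)` as a closed graph. -/

/-- The class in `L²(ℝ)` of a test function. -/
def testLp (φ : ℝ → ℂ) (hφ : Continuous φ) (hs : HasCompactSupport φ) : L2R :=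
  (hφ.memLp_of_hasCompactSupport (p := 2) hs).toLp φ

theorem inner_testLp {φ : ℝ → ℂ} (hφ : Continuous φ) (hs : HasCompactSupport φ) (f : L2R) :
    ⟪testLp φ hφ hs, f⟫_ℂ = ∫ y, f y * (starRingEnd ℂ) (φ y) := by
  rw [L2.inner_def]
  refine integral_congr_ae ((MemLp.coeFn_toLp (hφ.memLp_of_hasCompactSupport (p := 2) hs)).mono
    fun y hy => ?_)
  simp only [testLp, hy]
  rfl

theorem contDiff_conj {φ : ℝ → ℂ} (hφ : ContDiff ℝ ∞ φ) :
    ContDiff ℝ ∞ fun y => (starRingEnd ℂ) (φ y) :=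
  Complex.conjCLE.contDiff.comp hφ

theorem deriv_conj {φ : ℝ → ℂ} (hφ : ContDiff ℝ ∞ φ) (y : ℝ) :
    deriv (fun y => (starRingEnd ℂ) (φ y)) y = (starRingEnd ℂ) (deriv φ y) :=
  (Complex.conjCLE.toContinuousLinearMap.hasFDerivAt.comp_hasDerivAt y
    (hφ.differentiable (by simp) y).hasDerivAt).deriv

theorem hasCompactSupport_conj {φ : ℝ → ℂ} (hs : HasCompactSupport φ) :
    HasCompactSupport fun y => (starRingEnd ℂ) (φ y) :=
  hs.comp_left (map_zero _)

/-- The definition pairs without conjugation, so `φ` is replaced by its conjugate. In this form the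
condition is visibly closed in `L²`. -/
theorem isWeakDeriv_iff_inner {f g : L2R} : IsWeakDeriv f g ↔
    ∀ (φ : ℝ → ℂ) (hφ : ContDiff ℝ ∞ φ) (hs : HasCompactSupport φ),
      ⟪testLp (deriv φ) (hφ.continuous_deriv (by simp)) hs.deriv, f⟫_ℂ =
        -⟪testLp φ hφ.continuous hs, g⟫_ℂ := by
  constructor
  · intro h φ hφ hs
    rw [inner_testLp, inner_testLp]
    have := h _ (contDiff_conj hφ) (hasCompactSupport_conj hs)
    simpa only [deriv_conj hφ] using this
  · intro h φ hφ hs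
    have := h _ (contDiff_conj hφ) (hasCompactSupport_conj hs)
    rw [inner_testLp, inner_testLp] at this
    simpa only [deriv_conj hφ, Complex.conj_conj] using this

theorem isWeakDeriv_testLp {φ : ℝ → ℂ} (hφ : ContDiff ℝ ∞ φ) (hs : HasCompactSupport φ) :
    IsWeakDeriv (testLp φ hφ.continuous hs)
      (testLp (deriv φ) (hφ.continuous_deriv (by simp)) hs.deriv) := by
  intro χ hχ hχs
  have hφ' : Continuous (deriv φ) := hφ.continuous_deriv (by simp)
  have hχ' : Continuous (deriv χ) := hχ.continuous_deriv (by simp)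
  have e : ∀ {a b : ℝ → ℂ} (ha : Continuous a) (has : HasCompactSupport a),
      ∫ y, testLp a ha has y * b y = ∫ y, a y * b y := fun ha has =>
    integral_congr_ae ((MemLp.coeFn_toLp (ha.memLp_of_hasCompactSupport (p := 2) has)).mono
      fun y hy => by simp only [testLp, hy])
  rw [e, e]
  refine integral_mul_deriv_eq_deriv_mul_of_integrable
    (fun x _ => (hφ.differentiable (by simp) x).hasDerivAt)
    (fun x _ => (hχ.differentiable (by simp) x).hasDerivAt) ?_ ?_ ?_
  · exact (hφ.continuous.mul hχ').integrable_of_hasCompactSupport hs.mul_right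
  · exact (hφ'.mul hχ.continuous).integrable_of_hasCompactSupport hχs.mul_left
  · exact (hφ.continuous.mul hχ.continuous).integrable_of_hasCompactSupport hs.mul_right

/-- The graph `{(f, f')}` of the weak derivative, as a subspace of `L²(ℝ) ⊕ L²(ℝ)`. -/
def sobolevGraph : Submodule ℂ (Double L2R) where
  carrier := {q | IsWeakDeriv q.fst q.snd}
  zero_mem' := IsWeakDeriv.zero
  add_mem' ha hb := IsWeakDeriv.add ha hb
  smul_mem' c _ ha := IsWeakDeriv.smul c ha

theorem isClosed_sobolevGraph : IsClosed (sobolevGraph : Set (Double L2R)) := by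
  have : (sobolevGraph : Set (Double L2R)) = {q | IsWeakDeriv q.fst q.snd} := rfl
  rw [this]
  simp_rw [isWeakDeriv_iff_inner, Set.ofPred_forall]
  refine isClosed_iInter fun φ => isClosed_iInter fun hφ => isClosed_iInter fun hs => ?_
  exact isClosed_eq (continuous_const.inner (WithLp.fstL 2 ℂ L2R L2R).continuous)
    (continuous_const.inner (WithLp.sndL 2 ℂ L2R L2R).continuous).neg

/-- The pairs `(φ, φ')` with a test function `φ`. -/
def testGraph : Set (Double L2R) :=
  {q | ∃ (φ : ℝ → ℂ) (hφ : ContDiff ℝ ∞ φ) (hs : HasCompactSupport φ),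
    q = WithLp.toLp 2 (testLp φ hφ.continuous hs,
      testLp (deriv φ) (hφ.continuous_deriv (by simp)) hs.deriv)}

/-- Test functions are dense in the Sobolev space `H¹(ℝ)`. -/
theorem closure_span_testGraph :
    (Submodule.span ℂ testGraph).topologicalClosure = sobolevGraph := by
  have hle : (Submodule.span ℂ testGraph).topologicalClosure ≤ sobolevGraph := by
    refine Submodule.topologicalClosure_minimal _ (Submodule.span_le.2 ?_) isClosed_sobolevGraph
    rintro _ ⟨φ, hφ, hs, rfl⟩
    exact isWeakDeriv_testLp hφ hs
  have : CompleteSpace (Submodule.span ℂ testGraph).topologicalClosure :=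
    (Submodule.isClosed_topologicalClosure _).completeSpace_coe
  rw [← Submodule.sup_orthogonal_inf_of_hasOrthogonalProjection hle, eq_comm, sup_eq_left]
  rintro q ⟨hq1, hq2⟩
  have hd : IsWeakDeriv q.fst q.snd := hq2
  -- Orthogonality to all `(φ, φ')` says that `q.snd` has weak derivative `q.fst`. Hence `q.fst ±
  -- q.snd` solve `u' = ±u` and vanish.
  have hd2 : IsWeakDeriv q.snd q.fst := by
    rw [isWeakDeriv_iff_inner]
    intro φ hφ hs
    have := (Submodule.mem_orthogonal _ _).1 hq1 _ (Submodule.le_topologicalClosure _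
      (Submodule.subset_span ⟨φ, hφ, hs, rfl⟩))
    rw [inner_double] at this
    exact eq_neg_of_add_eq_zero_right this
  have h1 : q.fst + q.snd = 0 := by
    refine IsWeakDeriv.eq_zero_of_eq_smul (ε := 1) (by norm_num) ?_
    have := hd.add hd2
    rw [add_comm q.snd] at this
    rwa [Complex.ofReal_one, one_smul]
  have h2 : q.fst - q.snd = 0 := by
    refine IsWeakDeriv.eq_zero_of_eq_smul (ε := -1) (by norm_num) ?_
    have := hd.add (hd2.smul (-1))
    simpa [sub_eq_add_neg, add_comm] using this
  have h3 : q.fst = 0 := by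
    have : (2 : ℂ) • q.fst = 0 := by
      rw [two_smul]
      calc q.fst + q.fst = (q.fst + q.snd) + (q.fst - q.snd) := by abel
        _ = 0 := by rw [h1, h2, add_zero]
    exact (smul_eq_zero.1 this).resolve_left two_ne_zero
  have h4 : q.snd = 0 := by rwa [h3, zero_add] at h1
  have h5 : q = 0 := WithLp.ofLp_injective 2 (Prod.ext h3 h4)
  rw [h5]
  exact zero_mem _

/-- Integration by parts in `H¹(ℝ)`. -/
theorem IsWeakDeriv.inner_eq_neg {f g h k : L2R} (hf : IsWeakDeriv f g) (hh : IsWeakDeriv h k) :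
    ⟪g, h⟫_ℂ = -⟪f, k⟫_ℂ := by
  let S : Submodule ℂ (Double L2R) :=
    { carrier := {q | ⟪q.snd, h⟫_ℂ = -⟪q.fst, k⟫_ℂ}
      zero_mem' := by simp
      add_mem' := fun {a b} ha hb => by
        have ha' : ⟪a.snd, h⟫_ℂ = -⟪a.fst, k⟫_ℂ := ha
        have hb' : ⟪b.snd, h⟫_ℂ = -⟪b.fst, k⟫_ℂ := hb
        change ⟪a.snd + b.snd, h⟫_ℂ = -⟪a.fst + b.fst, k⟫_ℂ
        rw [inner_add_left, inner_add_left, ha', hb', neg_add]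
      smul_mem' := fun c a ha => by
        have ha' : ⟪a.snd, h⟫_ℂ = -⟪a.fst, k⟫_ℂ := ha
        change ⟪c • a.snd, h⟫_ℂ = -⟪c • a.fst, k⟫_ℂ
        rw [inner_smul_left, inner_smul_left, ha', mul_neg] }
  have hle : sobolevGraph ≤ S := by
    rw [← closure_span_testGraph]
    refine Submodule.topologicalClosure_minimal _ (Submodule.span_le.2 ?_) ?_
    · rintro _ ⟨φ, hφ, hs, rfl⟩
      exact isWeakDeriv_iff_inner.1 hh φ hφ hs
    · exact isClosed_eq ((WithLp.sndL 2 ℂ L2R L2R).continuous.inner continuous_const)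
        ((WithLp.fstL 2 ℂ L2R L2R).continuous.inner continuous_const).neg
  exact hle (x := WithLp.toLp 2 (f, g)) hf

/-- `-f'' + f = k` is solvable in `H²(ℝ)` for every `k` in `L²(ℝ)`. -/
theorem exists_isWeakDeriv_eq (k : L2R) :
    ∃ f g h : L2R, IsWeakDeriv f g ∧ IsWeakDeriv g h ∧ -h + f = k := by
  have : CompleteSpace sobolevGraph := isClosed_sobolevGraph.completeSpace_coe
  -- The projection of `(k, 0)` is some `(f, f')`, and the residual `(k - f, -f')` is orthogonal to
  -- every `(φ, φ')`, which says `f'' = f - k` weakly.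
  set q : Double L2R := WithLp.toLp 2 (k, 0) with hq
  set p := sobolevGraph.starProjection q with hp
  have hpm : p ∈ sobolevGraph := Submodule.starProjection_apply_mem _ _
  refine ⟨p.fst, p.snd, p.fst - k, hpm, ?_, by abel⟩
  rw [isWeakDeriv_iff_inner]
  intro φ hφ hs
  have h1 := Submodule.starProjection_inner_eq_zero (K := sobolevGraph) q
    (WithLp.toLp 2 (testLp φ hφ.continuous hs,
      testLp (deriv φ) (hφ.continuous_deriv (by simp)) hs.deriv)) (isWeakDeriv_testLp hφ hs)
  rw [← inner_conj_symm, map_eq_zero, inner_double] at h1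
  change ⟪testLp φ hφ.continuous hs, k - p.fst⟫_ℂ +
    ⟪testLp (deriv φ) (hφ.continuous_deriv (by simp)) hs.deriv, 0 - p.snd⟫_ℂ = 0 at h1
  rw [zero_sub, inner_neg_right, ← neg_sub p.fst, inner_neg_right] at h1
  linear_combination -h1

/-! ### Self-adjointness of the Hill operator. -/

theorem graph_hillOperator (U : ℝ → ℝ) : (hillOperator U).graph = hillGraph U :=
  Submodule.toLinearPMap_graph_eq _ (hillGraph_single_valued U)

theorem mem_hillGraph_zero {q : L2R × L2R} :
    q ∈ hillGraph 0 ↔ ∃ g h : L2R, IsWeakDeriv q.1 g ∧ IsWeakDeriv g h ∧ q.2 = -h := by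
  refine exists_congr fun g => exists_congr fun h => and_congr_right fun _ => and_congr_right
    fun _ => ?_
  have h1 : (fun y => -h y + (((0 : ℝ → ℝ) y : ℝ) : ℂ) * q.1 y) =ᵐ[volume] (-h : L2R) :=
    (Lp.coeFn_neg h).mono fun y hy => by
      simp only [hy, Pi.zero_apply, Complex.ofReal_zero, zero_mul, add_zero, Pi.neg_apply]
  exact ⟨fun h2 => Lp.ext (h2.trans h1), fun h2 => h2 ▸ h1.symm⟩

/-- The free operator `-d²/dy²` on `H²(ℝ)` is self-adjoint. -/
theorem isSelfAdjoint_hillOperator_zero : IsSelfAdjoint (hillOperator 0) := by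
  have hsurj : ∀ z, ∃ p ∈ (hillOperator 0).graph, p.2 + (1 : ℂ) • p.1 = z := by
    intro z
    obtain ⟨f, g, h, h1, h2, h3⟩ := exists_isWeakDeriv_eq z
    rw [graph_hillOperator]
    exact ⟨(f, -h), mem_hillGraph_zero.2 ⟨g, h, h1, h2, rfl⟩, by rw [one_smul]; exact h3⟩
  -- The shift `c = 1` is real, so one surjectivity statement serves for both `c` and `c̄`.
  refine isSelfAdjoint_of_surjective ?_ 1 hsurj (by simpa only [map_one] using hsurj)
  intro p hp q hq
  rw [graph_hillOperator] at hp hq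
  obtain ⟨g, h, h1, h2, h3⟩ := mem_hillGraph_zero.1 hp
  obtain ⟨g', h', h1', h2', h3'⟩ := mem_hillGraph_zero.1 hq
  rw [h3, h3', inner_neg_left, inner_neg_right, h2.inner_eq_neg h1', neg_neg, h1.inner_eq_neg h2']

/-- Multiplication by an essentially bounded function on `L²(ℝ)`. -/
def mulBounded (U : ℝ → ℝ) (hU : MemLp (fun y => (U y : ℂ)) ⊤ (volume : Measure ℝ)) :
    L2R →ₗ[ℂ] L2R where
  toFun f := ((Lp.memLp f).mul hU (r := 2)).toLp _
  map_add' f g := by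
    refine Lp.ext ?_
    filter_upwards [MemLp.coeFn_toLp ((Lp.memLp (f + g)).mul hU (r := 2)),
      MemLp.coeFn_toLp ((Lp.memLp f).mul hU (r := 2)),
      MemLp.coeFn_toLp ((Lp.memLp g).mul hU (r := 2)), Lp.coeFn_add f g,
      Lp.coeFn_add (((Lp.memLp f).mul hU (r := 2)).toLp _)
        (((Lp.memLp g).mul hU (r := 2)).toLp _)] with y e1 e2 e3 e4 e5
    rw [e1, e5, Pi.add_apply, e2, e3]
    simp only [Pi.mul_apply, e4, Pi.add_apply, mul_add]
  map_smul' c f := by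
    refine Lp.ext ?_
    filter_upwards [MemLp.coeFn_toLp ((Lp.memLp (c • f)).mul hU (r := 2)),
      MemLp.coeFn_toLp ((Lp.memLp f).mul hU (r := 2)), Lp.coeFn_smul c f,
      Lp.coeFn_smul c (((Lp.memLp f).mul hU (r := 2)).toLp _)] with y e1 e2 e3 e4
    rw [RingHom.id_apply, e1, e4, Pi.smul_apply, e2]
    simp only [Pi.mul_apply, e3, Pi.smul_apply, smul_eq_mul]
    ring

theorem coeFn_mulBounded (U : ℝ → ℝ) (hU : MemLp (fun y => (U y : ℂ)) ⊤ (volume : Measure ℝ))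
    (f : L2R) : mulBounded U hU f =ᵐ[volume] fun y => (U y : ℂ) * f y :=
  MemLp.coeFn_toLp ((Lp.memLp f).mul hU (r := 2))

theorem isSymmetric_mulBounded (U : ℝ → ℝ)
    (hU : MemLp (fun y => (U y : ℂ)) ⊤ (volume : Measure ℝ)) : (mulBounded U hU).IsSymmetric := by
  intro f g
  rw [L2.inner_def, L2.inner_def]
  refine integral_congr_ae ?_
  filter_upwards [coeFn_mulBounded U hU f, coeFn_mulBounded U hU g] with y e1 e2
  rw [e1, e2]
  simp [RCLike.inner_apply]
  ring

theorem hillOperator_eq_vadd (U : ℝ → ℝ) (hU : MemLp (fun y => (U y : ℂ)) ⊤ (volume : Measure ℝ)) :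
    hillOperator U = mulBounded U hU +ᵥ hillOperator 0 := by
  refine LinearPMap.eq_of_eq_graph ?_
  ext q
  rw [mem_graph_vadd, graph_hillOperator, graph_hillOperator, mem_hillGraph_zero]
  refine exists_congr fun g => exists_congr fun h => and_congr_right fun _ => and_congr_right
    fun _ => ?_
  have h1 : (fun y => -h y + (U y : ℂ) * q.1 y) =ᵐ[volume] (-h + mulBounded U hU q.1 : L2R) := by
    filter_upwards [coeFn_mulBounded U hU q.1, Lp.coeFn_neg h,
      Lp.coeFn_add (-h) (mulBounded U hU q.1)] with y e1 e2 e3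
    rw [e3, Pi.add_apply, e1, e2, Pi.neg_apply]
  rw [sub_eq_iff_eq_add]
  exact ⟨fun h2 => Lp.ext (h2.trans h1), fun h2 => h2 ▸ h1.symm⟩

/-- A continuous periodic potential is bounded, so both `U` and `-E_*` are bounded symmetric
perturbations of the free operator. -/
theorem isSelfAdjoint_qInf {U : ℝ → ℝ} (hU : Continuous U) {L : ℝ} (hL : L ≠ 0)
    (hUL : Function.Periodic U L) (Estar : ℝ) : IsSelfAdjoint (qInf U Estar) := by
  obtain ⟨C, hC⟩ := (hUL.isBounded_of_continuous hL hU).exists_norm_le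
  have hm : MemLp (fun y => (U y : ℂ)) ⊤ (volume : Measure ℝ) :=
    memLp_top_of_bound (Complex.continuous_ofReal.comp hU).aestronglyMeasurable C
      (Eventually.of_forall fun y => by
        rw [Complex.norm_real]
        exact hC _ ⟨y, rfl⟩)
  unfold qInf
  rw [hillOperator_eq_vadd U hm]
  refine (isSelfAdjoint_hillOperator_zero.bounded_vadd (isSymmetric_mulBounded U hm)).bounded_vadd ?_
  intro f g
  change ⟪-((Estar : ℂ) • f), g⟫_ℂ = ⟪f, -((Estar : ℂ) • g)⟫_ℂ
  rw [inner_neg_left, inner_neg_right, inner_smul_left, inner_smul_right, Complex.conj_ofReal]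

end WeakDerivative

/-! ### Hecke operators. -/

section Hecke

theorem rho_one (f : L2X) : rho 1 f = f := by
  refine (rho 1).injective ?_
  rw [rho_mul, one_mul]

theorem inner_rho_left (g : Ideles) (f h : L2X) : ⟪rho g f, h⟫_ℂ = ⟪f, rho g⁻¹ h⟫_ℂ := by
  rw [← (rho g⁻¹).inner_map_map, rho_mul, inv_mul_cancel, rho_one]

/-- Each `rho g` is unitary with adjoint `rho g⁻¹`, so the adjoint only exchanges the two summands.
-/
theorem isSelfAdjoint_heckeOperator (Φ₀ : L2X) (p : PrimeNumber) :
    IsSelfAdjoint (heckeOperator Φ₀ p) := by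
  rw [ContinuousLinearMap.isSelfAdjoint_iff_isSymmetric]
  intro f g
  change ⟪rho (uniformizer p) (f : L2X) + rho (uniformizer p)⁻¹ (f : L2X), (g : L2X)⟫_ℂ =
    ⟪(f : L2X), rho (uniformizer p) (g : L2X) + rho (uniformizer p)⁻¹ (g : L2X)⟫_ℂ
  rw [inner_add_left, inner_add_right, inner_rho_left, inner_rho_left, inv_inv, add_comm]

end Hecke

/-! ### The mass operator: norm, symmetry, compactness. -/

section Mass

variable {H : Type*} [NormedAddCommGroup H] [InnerProductSpace ℂ H]

theorem isSymmetric_chiralCLM {M : H →L[ℂ] H} (hM : M.IsSymmetric) :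
    (chiralCLM M).IsSymmetric := by
  intro x y
  change ⟪M x.snd, y.fst⟫_ℂ + ⟪M x.fst, y.snd⟫_ℂ = ⟪x.fst, M y.snd⟫_ℂ + ⟪x.snd, M y.fst⟫_ℂ
  rw [add_comm]
  exact congrArg₂ _ (hM _ _) (hM _ _)

theorem norm_chiralCLM_le (M : H →L[ℂ] H) : ‖chiralCLM M‖ ≤ ‖M‖ := by
  refine ContinuousLinearMap.opNorm_le_bound _ (norm_nonneg _) fun x => ?_
  refine le_of_sq_le_sq ?_ (by positivity)
  have h1 : ‖chiralCLM M x‖ ^ 2 = ‖M x.snd‖ ^ 2 + ‖M x.fst‖ ^ 2 :=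
    WithLp.prod_norm_sq_eq_of_L2 _
  have h2 : ‖x‖ ^ 2 = ‖x.fst‖ ^ 2 + ‖x.snd‖ ^ 2 := WithLp.prod_norm_sq_eq_of_L2 _
  rw [h1, mul_pow, h2, mul_add, ← mul_pow, ← mul_pow, add_comm]
  gcongr <;> exact M.le_opNorm _

theorem isCompactOperator_chiralCLM {M : H →L[ℂ] H} (hM : IsCompactOperator M) :
    IsCompactOperator (chiralCLM M) := by
  have h1 : IsCompactOperator (ContinuousLinearMap.inl ℂ H H ∘L M ∘L WithLp.sndL 2 ℂ H H) :=
    (hM.comp_clm (WithLp.sndL 2 ℂ H H)).clm_comp (ContinuousLinearMap.inl ℂ H H)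
  have h2 : IsCompactOperator (ContinuousLinearMap.inr ℂ H H ∘L M ∘L WithLp.fstL 2 ℂ H H) :=
    (hM.comp_clm (WithLp.fstL 2 ℂ H H)).clm_comp (ContinuousLinearMap.inr ℂ H H)
  have h3 := (h1.add h2).clm_comp
    (WithLp.prodContinuousLinearEquiv 2 ℂ H H).symm.toContinuousLinearMap
  refine (congrArg IsCompactOperator (funext fun x => ?_)).mpr h3
  refine WithLp.ofLp_injective 2 (Prod.ext ?_ ?_)
  · exact (add_zero (M x.snd)).symm
  · exact (zero_add (M x.fst)).symm

variable [CompleteSpace H]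

/-- Over `ℂ`, a bounded operator with real quadratic form is symmetric. -/
theorem isSymmetric_borelCalculus (T : H →L[ℂ] H) {η : ℝ → ℝ} (hη : Measurable η) {C : ℝ}
    (hC : ∀ t, |η t| ≤ C) : (borelCalculus T η).IsSymmetric := by
  refine (LinearMap.isSymmetric_iff_inner_map_self_real _).2 fun x => ?_
  change (starRingEnd ℂ) ⟪borelCalculus T η x, x⟫_ℂ = ⟪borelCalculus T η x, x⟫_ℂ
  have h := inner_borelCalculus T hη hC x
  rw [inner_conj_symm, ← inner_conj_symm (borelCalculus T η x), h, Complex.conj_ofReal]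

/-- The Rayleigh quotient gives the sharp constant `C`; the polarised form used for existence only
gives `2 * C`. -/
theorem norm_borelCalculus_le (T : H →L[ℂ] H) {η : ℝ → ℝ} (hη : Measurable η) {C : ℝ}
    (hC : ∀ t, |η t| ≤ C) : ‖borelCalculus T η‖ ≤ C := by
  rw [ContinuousLinearMap.norm_eq_iSup_rayleighQuotient _ (isSymmetric_borelCalculus T hη hC)]
  refine ciSup_le fun x => ?_
  have hC0 : 0 ≤ C := (abs_nonneg _).trans (hC 0)
  have h1 : (borelCalculus T η).reApplyInnerSelf x = spectralForm T η x := by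
    rw [ContinuousLinearMap.reApplyInnerSelf_apply, ← inner_conj_symm,
      inner_borelCalculus T hη hC x, Complex.conj_ofReal]
    rfl
  rw [ContinuousLinearMap.rayleighQuotient, h1, abs_div, abs_of_nonneg (sq_nonneg ‖x‖)]
  exact div_le_of_le_mul₀ (sq_nonneg _) hC0 (abs_spectralForm_le T hC x)

variable {T : PrimeNumber → H →L[ℂ] H} {η : PrimeNumber → ℝ → ℝ}

theorem summable_massTerm (hη : ∀ p, Measurable (η p))
    (hb : ∀ p, BddAbove (Set.range fun t => |η p t|)) (hs : Summable fun p => ⨆ t, |η p t|) :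
    Summable (massTerm T η) :=
  Summable.of_norm_bounded hs fun p => (norm_chiralCLM_le _).trans
    (norm_borelCalculus_le (T p) (hη p) fun t => le_ciSup (hb p) t)

/-- The adjoint commutes with `∑'`, so it is enough to treat each mass term. -/
theorem isSelfAdjoint_massOperator (hη : ∀ p, Measurable (η p))
    (hb : ∀ p, BddAbove (Set.range fun t => |η p t|)) : IsSelfAdjoint (massOperator T η) := by
  refine (tsum_star (f := massTerm T η)).trans (tsum_congr fun p => ?_)
  exact ContinuousLinearMap.isSelfAdjoint_iff_isSymmetric.2 (isSymmetric_chiralCLM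
    (isSymmetric_borelCalculus (T p) (hη p) fun t => le_ciSup (hb p) t))

/-- Finite partial sums are compact, and compactness survives norm limits. -/
theorem isCompactOperator_massOperator (hs : Summable (massTerm T η))
    (hc : ∀ p, IsCompactOperator (borelCalculus (T p) (η p))) :
    IsCompactOperator (massOperator T η) := by
  refine isCompactOperator_of_tendsto (l := Filter.atTop) hs.hasSum
    (Filter.Eventually.of_forall fun s => ?_)
  exact (compactOperator (RingHom.id ℂ) (Double H) (Double H)).sum_mem fun p _ =>
    isCompactOperator_chiralCLM (hc p)

end Mass

/-! ### Assembly of the theorem. -/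

section Main

theorem isSelfAdjoint_dGlobPhys {K : Type*} [NormedAddCommGroup K] [InnerProductSpace ℂ K]
    (W : L2X ≃ₗᵢ[ℂ] HilbertTensor L2R K) {U : ℝ → ℝ} (hU : Continuous U) {L : ℝ} (hL : L ≠ 0)
    (hUL : Function.Periodic U L) (Estar : ℝ) (Φ₀ : L2X)
    (hred : IsReducedBy (physProj Φ₀) (dGlob W U Estar)) :
    IsSelfAdjoint (dGlobPhys W U Estar Φ₀) := by
  have hD : IsSelfAdjoint (dGlob W U Estar) :=
    isSelfAdjoint_tensorId W (isSelfAdjoint_chiral (isSelfAdjoint_qInf hU hL hUL Estar))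
  -- The adjoint of the inclusion is the componentwise orthogonal projection onto the subspace;
  -- followed by the inclusion it is `physProj`, so `hred` is the required reduction.
  refine isSelfAdjoint_part (P := diagCLM (HPhys Φ₀).orthogonalProjectionOnto) hD ?_ ?_ hred
  · intro x y
    refine congrArg₂ (· + ·) ?_ ?_
    · exact Submodule.inner_orthogonalProjectionOnto_eq_of_mem_right y.fst x.fst
    · exact Submodule.inner_orthogonalProjectionOnto_eq_of_mem_right y.snd x.snd
  · intro x
    refine WithLp.ofLp_injective 2 (Prod.ext ?_ ?_)
    · exact Submodule.orthogonalProjectionOnto_mem_subspace_eq_self x.fst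
    · exact Submodule.orthogonalProjectionOnto_mem_subspace_eq_self x.snd

end Main

end AdelicDirac

end

theorem mainTheorem1 {K : Type*} [NormedAddCommGroup K] [InnerProductSpace ℂ K] [CompleteSpace K]
    (W : AdelicDirac.L2X ≃ₗᵢ[ℂ] AdelicDirac.HilbertTensor AdelicDirac.L2R K)
    (U : ℝ → ℝ) (hU : ContDiff ℝ ∞ U) (L : ℝ) (hL : 0 < L) (hUL : Function.Periodic U L)
    (Estar : ℝ) (Φ₀ : AdelicDirac.L2X)
    (hred : AdelicDirac.IsReducedBy (AdelicDirac.physProj Φ₀) (AdelicDirac.dGlob W U Estar)) :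
    (∀ p, IsSelfAdjoint (AdelicDirac.heckeOperator Φ₀ p)) ∧
    ∀ (T : AdelicDirac.PrimeNumber → AdelicDirac.HPhys Φ₀ →L[ℂ] AdelicDirac.HPhys Φ₀)
      (_ : ∀ p, IsSelfAdjoint (T p))
      (η : AdelicDirac.PrimeNumber → ℝ → ℝ) (_ : ∀ p, Measurable (η p))
      (_ : ∀ p, BddAbove (Set.range fun t => |η p t|))
      (_ : Summable fun p => ⨆ t, |η p t|),
      Summable (AdelicDirac.massTerm T η) ∧
      IsSelfAdjoint (AdelicDirac.massOperator T η) ∧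
      Dense ((AdelicDirac.dArith W U Estar Φ₀ T η).domain :
        Set (AdelicDirac.Double (AdelicDirac.HPhys Φ₀))) ∧
      IsSelfAdjoint (AdelicDirac.dArith W U Estar Φ₀ T η) ∧
      ((∀ p, IsCompactOperator (AdelicDirac.borelCalculus (T p) (η p))) →
        (Summable fun p => ‖AdelicDirac.borelCalculus (T p) (η p)‖) →
        IsCompactOperator (AdelicDirac.massOperator T η) ∧
        AdelicDirac.essSpectrum (AdelicDirac.dArith W U Estar Φ₀ T η) =
          AdelicDirac.essSpectrum (AdelicDirac.dGlobPhys W U Estar Φ₀)) := by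
  refine ⟨AdelicDirac.isSelfAdjoint_heckeOperator Φ₀, fun T _ η hη hb hsum => ?_⟩
  have hsm := AdelicDirac.summable_massTerm (T := T) hη hb hsum
  have hMs := AdelicDirac.isSelfAdjoint_massOperator (T := T) hη hb
  have hD := AdelicDirac.isSelfAdjoint_dGlobPhys W hU.continuous hL.ne' hUL Estar Φ₀ hred
  have hA : IsSelfAdjoint (AdelicDirac.dArith W U Estar Φ₀ T η) :=
    hD.bounded_vadd (ContinuousLinearMap.isSelfAdjoint_iff_isSymmetric.1 hMs)
  refine ⟨hsm, hMs, hA.dense_domain, hA, fun hc _ => ?_⟩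
  have hMc := AdelicDirac.isCompactOperator_massOperator hsm hc
  exact ⟨hMc, AdelicDirac.essSpectrum_vadd_compact hD.isClosed hMc⟩
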